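/- Let $\ell\ge 1$ and let $Q=\bigoplus_{i=1}^{\ell}\mathbb{Z}v_i$ carry the bilinear form $(v_i|v_j)=\delta_{ij}$ and the bi-multiplicative function $\varepsilon:Q\times Q\to\{\pm1\}$ with $\varepsilon(v_i,v_j)=\epsilon_{ij}$, where $\epsilon_{ij}=1$ for $i<j$ and $\epsilon_{ij}=-1$ for $i\ge j$. Put $\mathfrak h=\mathbb{C}\otimes Q$, let $S$ be the symmetric algebra of $\bigoplus_{n>0}\mathfrak h s^{-n}$, and let $V_Q=S\otimes\mathbb{C}_\varepsilon[Q]$ be the lattice vertex algebra with vacuum $|0\rangle=1\otimes e^0$. For $h\in\mathfrak h$ let $h_{(-n)}$ ($n>0$) be multiplication by $hs^{-n}$, let $h_{(n)}$ ($n>0$) be the derivation of $S$ with $h's^{-k}\mapsto\delta_{n,k}\,n\,(h|h')$, let $h_{(0)}(g\otimes e^\beta)=(h|\beta)\,g\otimes e^\beta$, and for $\alpha\in Q$ put $$E^\alpha(z)=\sum_{m\in\mathbb{Z}}(e^\alpha)_{(m)}z^{-m-1}=e^\alpha z^{\alpha_{(0)}}\exp\Big(\sum_{n>0}\alpha_{(-n)}\tfrac{z^n}{n}\Big)\exp\Big(\sum_{n<0}\alpha_{(-n)}\tfrac{z^n}{n}\Big),\qquad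 e^\alpha(g\otimes e^\beta)=\varepsilon(\alpha,\beta)\,g\otimes e^{\alpha+\beta}.$$ Let $\mathfrak g\subset\mathrm{End}(V_Q)$ be the linear span of $\mathrm{Id}$, of $(v_i-v_{i+1})_{(m)}$ ($1\le i<\ell$) and of $\epsilon_{lk}(e^{v_k-v_l})_{(m)}$ ($k\ne l$), $m\in\mathbb{Z}$; this is the realization of the affine Lie algebra $\mathcal{L}(\mathfrak{sl}_\ell)$ in $V_Q$. Let $\boldsymbol x=(x^{(i)}_n)_{1\le i\le\ell,\,n\ge1}$, $\boldsymbol u=(u_1,\dots,u_\ell)$, $\boldsymbol u^{\underline\alpha}=u_1^{j_1}\cdots u_\ell^{j_\ell}$ for $\alpha=\sum_i j_iv_i$, and let $\Pi:V_Q\to\mathbb{C}[\boldsymbol x,\boldsymbol u,\boldsymbol u^{-1}]$ be the linear isomorphism $$v_{i_1}s^{-m_1}\cdots v_{i_k}s^{-m_k}\otimes e^{\alpha}\mapsto m_1\cdots m_k\,x^{(i_1)}_{m_1}\cdots x^{(i_k)}_{m_k}\,\boldsymbol u^{\underline\alpha}.$$ Let $Q_0=\{\sum_i j_iv_i\in Q:\sum_i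 j_i=0\}$, $\xi(\boldsymbol x^{(k)},z)=\sum_{n>0}x^{(k)}_nz^n$, let $\boldsymbol x\pm[z^{-1}]^{(k)}$ denote the substitution $x^{(k)}_n\mapsto x^{(k)}_n\pm\frac{1}{nz^n}$ for all $n\ge1$, and let $\mathrm{Res}_z\sum_p g_pz^p=g_{-1}$. (1) Let $X\in\mathfrak g$ be such that the series $e^X|0\rangle=\sum_{n\ge0}\frac{1}{n!}X^n|0\rangle$ converges (absolutely) in each coefficient, and write $\Pi(e^X|0\rangle)=\sum_{\alpha\in Q}\tau_\alpha(\boldsymbol x)\boldsymbol u^{\underline\alpha}$ with formal power series $\tau_\alpha\in\mathbb{C}[[\boldsymbol x]]$ (polynomials if $e^X|0\rangle\in V_Q$). Then $\tau_\alpha=0$ for $\alpha\notin Q_0$, and the tau functions $\tau_\alpha$, $\alpha\in Q_0$, satisfy the Hirota bilinear equations $$\sum_{k=1}^{\ell}\varepsilon(v_k,\alpha-\beta+v_i+v_j)\,\mathrm{Res}_z\Big(z^{(v_k|\alpha-\beta)+m-2+\delta_{ik}+\delta_{jk}}\,e^{\xi(\boldsymbol x^{(k)}-\boldsymbol x'^{(k)},z)}\,\tau_{\alpha+v_i-v_k}\big(\boldsymbol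 x-[z^{-1}]^{(k)}\big)\,\tau_{\beta-v_j+v_k}\big(\boldsymbol x'+[z^{-1}]^{(k)}\big)\Big)=0\qquad(\ast)$$ for all $m\in\mathbb{Z}_{\ge0}$, $\alpha,\beta\in Q_0$ and $i,j\in\{1,\dots,\ell\}$. (2) For every family $(\tau_\alpha)$ of formal power series in $\boldsymbol x$, the system $(\ast)$ holds if and only if the family satisfies the $(1,\dots,1)$-reduction of the $\ell$-component KP hierarchy, that is, the case $\lambda_1=\dots=\lambda_\ell=1$ of the system $$\sum_{k=1}^{\ell}\varepsilon(v_k,\alpha+\beta)\,\mathrm{Res}_z\Big(z^{(v_k|\alpha-\beta)+m\lambda_k-2+2\delta_{k\ell}}\,e^{\xi(\boldsymbol x^{(k)}-\boldsymbol x'^{(k)},z)}\,\tau_{\alpha+v_\ell-v_k}\big(\boldsymbol x-[z^{-1}]^{(k)}\big)\,\tau_{\beta-v_\ell+v_k}\big(\boldsymbol x'+[z^{-1}]^{(k)}\big)\Big)=0,\qquad m\in\mathbb{Z}_{\ge0},\ \alpha,\beta\in Q_0.$$ -/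

import Mathlib

open scoped Nat

noncomputable section

namespace LatticeVA

/-! ### The lattice, its bilinear form and the bi-multiplicative function -/

/-- The lattice `Q = ⊕ ℤ v_i` of rank `ℓ`, in coordinates with respect to `(v_1, …, v_ℓ)`. -/
abbrev Q (ℓ : ℕ) := Fin ℓ → ℤ

/-- The basis vector `v_i`. -/
def v {ℓ : ℕ} (i : Fin ℓ) : Q ℓ := Pi.single i 1

/-- The symmetric bilinear form with `(v_i | v_j) = δ_{ij}`. -/
def form {ℓ : ℕ} (α β : Q ℓ) : ℤ := ∑ i, α i * β i

/-- `ε_{ij} = 1` for `i < j` and `ε_{ij} = -1` for `i ≥ j`. -/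
def epsBasis {ℓ : ℕ} (i j : Fin ℓ) : ℤˣ := if i < j then 1 else -1

/-- The bi-multiplicative function `ε : Q × Q → {±1}` with `ε(v_i, v_j) = ε_{ij}`. -/
def eps {ℓ : ℕ} (α β : Q ℓ) : ℤˣ := ∏ i, ∏ j, epsBasis i j ^ (α i * β j)

/-- The sign `ε(α, β)` as a complex number. -/
def epsC {ℓ : ℕ} (α β : Q ℓ) : ℂ := ((eps α β : ℤ) : ℂ)

/-- The root lattice `Q_0 = {∑ j_i v_i | ∑ j_i = 0}` of `sl_ℓ`. -/
def rootLattice (ℓ : ℕ) : AddSubgroup (Q ℓ) where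
  carrier := {α | ∑ i, α i = 0}
  add_mem' := by
    intro a b ha hb
    simp only [Set.mem_ofPred_eq, Pi.add_apply, Finset.sum_add_distrib] at *
    rw [ha, hb, add_zero]
  zero_mem' := by simp
  neg_mem' := by
    intro a ha
    simp only [Set.mem_ofPred_eq, Pi.neg_apply, Finset.sum_neg_distrib] at *
    rw [ha, neg_zero]

/-! ### The state space `V_Q` -/

/-- Pairs `(i, n)` with `1 ≤ i ≤ ℓ` and `n > 0`. -/
abbrev Var (ℓ : ℕ) := Fin ℓ × ℕ+

/-- The symmetric algebra over `⊕_{n > 0} 𝔥 s^{-n}`, `𝔥 = ℂ ⊗ Q`: the polynomial algebra on the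
basis elements `v_i s^{-n}`. -/
abbrev SymAlg (ℓ : ℕ) := MvPolynomial (Var ℓ) ℂ

/-- The state space `V_Q = S ⊗ ℂ_ε[Q]`; the element `g ⊗ e^β` is `Finsupp.single β g`. -/
abbrev VQ (ℓ : ℕ) := Q ℓ →₀ SymAlg ℓ

/-- The vacuum `1 ⊗ e^0`. -/
def vac (ℓ : ℕ) : VQ ℓ := Finsupp.single 0 1

/-- The element `α ∈ Q` as an element of `𝔥`. -/
def toH {ℓ : ℕ} (α : Q ℓ) : Fin ℓ → ℂ := fun i => (α i : ℂ)

/-- The operator `h_{(-n)}`, `n > 0`, on `S`: multiplication by `h s^{-n}`. -/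
def heisNeg {ℓ : ℕ} (h : Fin ℓ → ℂ) (n : ℕ+) : Module.End ℂ (SymAlg ℓ) :=
  LinearMap.mulLeft ℂ (∑ i, h i • (MvPolynomial.X (i, n) : SymAlg ℓ))

/-- The operator `h_{(n)}`, `n > 0`, on `S`: the derivation with
`h' s^{-k} ↦ δ_{n,k} n (h | h')`. -/
def heisPos {ℓ : ℕ} (h : Fin ℓ → ℂ) (n : ℕ+) : Module.End ℂ (SymAlg ℓ) :=
  ∑ i, (h i * ((n : ℕ) : ℂ)) • (MvPolynomial.pderiv (R := ℂ) (i, n)).toLinearMap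

/-- The modes `h_{(m)}`, `m ∈ ℤ`, of the field `h(z) = ∑ h_{(m)} z^{-m-1}` on `V_Q`. -/
def heis {ℓ : ℕ} (h : Fin ℓ → ℂ) : ℤ → Module.End ℂ (VQ ℓ)
  | Int.ofNat 0 =>
      Finsupp.lsum ℂ fun β => (∑ i, h i * (β i : ℂ)) • Finsupp.lsingle (R := ℂ) β
  | Int.ofNat (n + 1) => Finsupp.mapRange.linearMap (heisPos h n.succPNat)
  | Int.negSucc n => Finsupp.mapRange.linearMap (heisNeg h n.succPNat)

/-- The exponential `∑_j f^j / j!` of a power series `f` without constant term over a (not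
necessarily commutative) `ℂ`-algebra; `f^j` does not contribute to the coefficient of `z^k` when
`j > k`. -/
def expSeries {A : Type*} [Ring A] [Algebra ℂ A] (f : PowerSeries A) : PowerSeries A :=
  PowerSeries.mk fun k => ∑ j ∈ Finset.range (k + 1), ((j ! : ℕ) : ℂ)⁻¹ • PowerSeries.coeff k (f ^ j)

/-- `exp (∑_{n > 0} α_{(-n)} z^n / n)`, a power series in `z`. -/
def gammaPlus {ℓ : ℕ} (α : Q ℓ) : PowerSeries (Module.End ℂ (SymAlg ℓ)) :=
  expSeries (PowerSeries.mk fun n =>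
    if hn : 0 < n then (n : ℂ)⁻¹ • heisNeg (toH α) ⟨n, hn⟩ else 0)

/-- `exp (∑_{n < 0} α_{(-n)} z^n / n) = exp (- ∑_{n > 0} α_{(n)} z^{-n} / n)`, a power series in
`z⁻¹`. -/
def gammaMinus {ℓ : ℕ} (α : Q ℓ) : PowerSeries (Module.End ℂ (SymAlg ℓ)) :=
  expSeries (PowerSeries.mk fun n =>
    if hn : 0 < n then -(n : ℂ)⁻¹ • heisPos (toH α) ⟨n, hn⟩ else 0)

/-- The polynomials of weighted degree at most `W`, where `v_i s^{-n}` has degree `n`. -/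
def filt (ℓ : ℕ) (W : ℤ) : Submodule ℂ (SymAlg ℓ) where
  carrier := {g | ∀ d, MvPolynomial.coeff d g ≠ 0 →
    ((Finsupp.weight (fun p : Var ℓ => (p.2 : ℕ)) d : ℕ) : ℤ) ≤ W}
  add_mem' := by
    intro a b ha hb d hd
    by_cases h : MvPolynomial.coeff d a = 0
    · refine hb d ?_
      intro h'
      exact hd (by rw [MvPolynomial.coeff_add, h, h', add_zero])
    · exact ha d h
  zero_mem' := by intro d hd; simp at hd
  smul_mem' := by
    intro c a ha d hd
    refine ha d ?_
    intro h
    exact hd (by rw [MvPolynomial.coeff_smul, h, smul_zero])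

theorem filt_mono {ℓ : ℕ} {W W' : ℤ} (h : W ≤ W') : filt ℓ W ≤ filt ℓ W' :=
  fun _ hg d hd => (hg d hd).trans h

theorem filt_neg {ℓ : ℕ} {W : ℤ} (hW : W < 0) {g : SymAlg ℓ} (hg : g ∈ filt ℓ W) : g = 0 := by
  ext d
  by_contra h
  have := hg d (by simpa using h)
  omega

theorem exists_mem_filt {ℓ : ℕ} (g : SymAlg ℓ) : ∃ W : ℤ, g ∈ filt ℓ W := by
  refine ⟨((g.support.sup fun d => Finsupp.weight (fun p : Var ℓ => (p.2 : ℕ)) d : ℕ) : ℤ), ?_⟩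
  intro d hd
  exact_mod_cast Finset.le_sup (f := fun d => Finsupp.weight (fun p : Var ℓ => (p.2 : ℕ)) d)
    (MvPolynomial.mem_support_iff.2 hd)

theorem heisPos_mem_filt {ℓ : ℕ} (h : Fin ℓ → ℂ) (n : ℕ+) {W : ℤ} {g : SymAlg ℓ}
    (hg : g ∈ filt ℓ W) : heisPos h n g ∈ filt ℓ (W - (n : ℕ)) := by
  simp only [heisPos, LinearMap.sum_apply, LinearMap.smul_apply]
  refine Submodule.sum_mem _ fun i _ => Submodule.smul_mem _ _ ?_
  intro d hd
  have hc : MvPolynomial.coeff (d + Finsupp.single (i, n) 1) g ≠ 0 := by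
    intro h0
    apply hd
    change MvPolynomial.coeff d (MvPolynomial.pderiv (i, n) g) = 0
    rw [MvPolynomial.coeff_pderiv, h0, zero_mul]
  have := hg _ hc
  rw [map_add, Finsupp.weight_single] at this
  simp only [smul_eq_mul, one_mul, Nat.cast_add] at this
  omega

theorem pow_mem_filt {ℓ : ℕ} (f : PowerSeries (Module.End ℂ (SymAlg ℓ)))
    (hf : ∀ (n : ℕ) (W : ℤ) (g : SymAlg ℓ), g ∈ filt ℓ W → PowerSeries.coeff n f g ∈ filt ℓ (W - n))
    (j n : ℕ) (W : ℤ) (g : SymAlg ℓ) (hg : g ∈ filt ℓ W) :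
    PowerSeries.coeff n (f ^ j) g ∈ filt ℓ (W - n) := by
  induction j generalizing n W g with
  | zero =>
    rw [pow_zero, PowerSeries.coeff_one]
    split_ifs with h
    · subst h
      simpa using hg
    · simp
  | succ j ih =>
    rw [pow_succ, PowerSeries.coeff_mul, LinearMap.sum_apply]
    refine Submodule.sum_mem _ fun p hp => ?_
    have hp' : p.1 + p.2 = n := Finset.HasAntidiagonal.mem_antidiagonal.1 hp
    have := ih p.1 _ _ (hf p.2 W g hg)
    have e : W - (p.2 : ℤ) - (p.1 : ℤ) = W - n := by omega
    rw [e] at this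
    exact this

theorem gammaMinus_mem_filt {ℓ : ℕ} (α : Q ℓ) (n : ℕ) (W : ℤ) (g : SymAlg ℓ) (hg : g ∈ filt ℓ W) :
    PowerSeries.coeff n (gammaMinus α) g ∈ filt ℓ (W - n) := by
  rw [gammaMinus, expSeries, PowerSeries.coeff_mk, LinearMap.sum_apply]
  refine Submodule.sum_mem _ fun j _ => ?_
  rw [LinearMap.smul_apply]
  refine Submodule.smul_mem _ _ (pow_mem_filt _ ?_ j n W g hg)
  intro n W g hg
  rw [PowerSeries.coeff_mk]
  split_ifs with hn
  · rw [LinearMap.smul_apply]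
    exact Submodule.smul_mem _ _ (heisPos_mem_filt _ ⟨n, hn⟩ hg)
  · simp

/-- Only finitely many terms of
`exp (∑_{n>0} α_{(-n)} z^n / n) exp (∑_{n<0} α_{(-n)} z^n / n) g` contribute to `z^k`. -/
theorem vertexS_finite {ℓ : ℕ} (α : Q ℓ) (k : ℤ) (g : SymAlg ℓ) :
    (Function.support fun pq : {pq : ℕ × ℕ // (pq.1 : ℤ) - pq.2 = k} =>
      PowerSeries.coeff pq.1.1 (gammaPlus α) (PowerSeries.coeff pq.1.2 (gammaMinus α) g)).Finite := by
  obtain ⟨W, hW⟩ := exists_mem_filt g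
  refine Set.Finite.of_injOn (f := fun pq => pq.1.2) (t := {q : ℕ | (q : ℤ) ≤ W}) ?_ ?_ ?_
  · rintro ⟨⟨p, q⟩, h⟩ hpq
    simp only [Set.mem_ofPred_eq]
    by_contra hq
    apply hpq
    have := filt_neg (by omega) (gammaMinus_mem_filt α q W g hW)
    simp only
    rw [this, map_zero]
  · rintro ⟨⟨p, q⟩, h⟩ _ ⟨⟨p', q'⟩, h'⟩ _ e
    simp only at e h h'
    subst e
    have : p = p' := by omega
    subst this
    rfl
  · refine (Set.finite_le_nat W.toNat).subset ?_
    intro q hq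
    simp only [Set.mem_ofPred_eq] at hq ⊢
    omega

/-- The coefficient of `z^k` in
`exp (∑_{n>0} α_{(-n)} z^n / n) exp (∑_{n<0} α_{(-n)} z^n / n)`, acting on `S`. -/
def vertexS {ℓ : ℕ} (α : Q ℓ) (k : ℤ) : Module.End ℂ (SymAlg ℓ) where
  toFun g := ∑ᶠ pq : {pq : ℕ × ℕ // (pq.1 : ℤ) - pq.2 = k},
    PowerSeries.coeff pq.1.1 (gammaPlus α) (PowerSeries.coeff pq.1.2 (gammaMinus α) g)
  map_add' a b := by
    rw [← finsum_add_distrib (vertexS_finite α k a) (vertexS_finite α k b)]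
    simp only [map_add]
  map_smul' c a := by
    rw [RingHom.id_apply, smul_finsum' c (vertexS_finite α k a)]
    simp only [map_smul]

/-- The mode `(e^α)_{(m)}`: the coefficient of `z^{-m-1}` in the field
`E^α(z) = e^α z^{α_{(0)}} exp (∑_{n>0} α_{(-n)} z^n / n) exp (∑_{n<0} α_{(-n)} z^n / n)`, where
`e^α (g ⊗ e^β) = ε(α, β) g ⊗ e^{α+β}` and `z^{α_{(0)}} (g ⊗ e^β) = z^{(α|β)} g ⊗ e^β`. -/
def expMode {ℓ : ℕ} (α : Q ℓ) (m : ℤ) : Module.End ℂ (VQ ℓ) :=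
  Finsupp.lsum ℂ fun β =>
    epsC α β • (Finsupp.lsingle (R := ℂ) (α + β)).comp (vertexS α (-m - 1 - form α β))

/-! ### The affine Lie algebra realized in `V_Q` -/

/-- The modes `a_{(m)}` of `a = v_i - v_{i+1}` and of `a = e_{kl} = ε_{lk} e^{v_k - v_l}`, `k ≠ l`. -/
inductive IsGenMode {ℓ : ℕ} : Module.End ℂ (VQ ℓ) → Prop
  | cartan (i j : Fin ℓ) (hij : (i : ℕ) + 1 = j) (m : ℤ) : IsGenMode (heis (toH (v i - v j)) m)
  | root (k l : Fin ℓ) (hkl : k ≠ l) (m : ℤ) :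
      IsGenMode (epsC (v l) (v k) • expMode (v k - v l) m)

/-- The affine Lie algebra `𝔤 = ⊕ ℂ a_{(m)} ⊕ ℂ Id ≅ L(sl_ℓ)` of operators on `V_Q`. -/
def affineAlg (ℓ : ℕ) : Submodule ℂ (Module.End ℂ (VQ ℓ)) :=
  Submodule.span ℂ ({T | IsGenMode T} ∪ {1})

/-! ### Tau functions of the vacuum orbit -/

/-- The isomorphism `Π : V_Q → ℂ[x, u, u⁻¹]`, `v_i s^{-n} ↦ n x_n^{(i)}`, `e^α ↦ u^α`; the
polynomial coefficient of `u^α` in an element `F` of the target is `F α`. -/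
def piMap (ℓ : ℕ) : VQ ℓ →ₗ[ℂ] (Q ℓ →₀ MvPolynomial (Var ℓ) ℂ) :=
  Finsupp.mapRange.linearMap
    (MvPolynomial.aeval fun p : Var ℓ =>
      (((p.2 : ℕ) : ℂ) • MvPolynomial.X p : MvPolynomial (Var ℓ) ℂ)).toLinearMap

/-- `τ = Π(e^X |0⟩) = ∑_α τ_α(x) u^α`, where the series `e^X |0⟩ = ∑_n X^n |0⟩ / n!` converges
coefficientwise: the coefficients `τ_α` are formal power series in `x`, and they are polynomials when
`e^X |0⟩` lies in `V_Q`. -/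
def IsVacuumTau {ℓ : ℕ} (X : Module.End ℂ (VQ ℓ)) (τ : Q ℓ → MvPowerSeries (Var ℓ) ℂ) : Prop :=
  ∀ (α : Q ℓ) (d : Var ℓ →₀ ℕ),
    HasSum (fun n : ℕ => ((n ! : ℕ) : ℂ)⁻¹ * MvPolynomial.coeff d (piMap ℓ ((X ^ n) (vac ℓ)) α))
      (MvPowerSeries.coeff d (τ α))

/-! ### Hirota bilinear expressions -/

theorem exists_term_ne_zero {ι : Sort*} {f : ι → ℂ} (h : ∑ᶠ i, f i ≠ 0) : ∃ i, f i ≠ 0 := by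
  by_contra! hn
  exact h (by simp [hn])

/-- The variables `x`, `x'`, and two further letters, `z` and `w`, the latter standing for `z⁻¹`. -/
abbrev BigVar (ℓ : ℕ) := (Var ℓ ⊕ Var ℓ) ⊕ Fin 2

/-- Formal power series in `x`, `x'`, `z` and `w`. -/
abbrev Big (ℓ : ℕ) := MvPowerSeries (BigVar ℓ) ℂ

/-- `x_n^{(i)}` -/
def bx {ℓ : ℕ} (p : Var ℓ) : Big ℓ := MvPowerSeries.X (Sum.inl (Sum.inl p))

/-- `x'_n^{(i)}` -/
def bx' {ℓ : ℕ} (p : Var ℓ) : Big ℓ := MvPowerSeries.X (Sum.inl (Sum.inr p))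

/-- `z` -/
def bz {ℓ : ℕ} : Big ℓ := MvPowerSeries.X (Sum.inr 0)

/-- `w`, which stands for `z⁻¹` -/
def bw {ℓ : ℕ} : Big ℓ := MvPowerSeries.X (Sum.inr 1)

/-- `ξ(x^{(k)} - x'^{(k)}, z) = ∑_{n>0} (x_n^{(k)} - x'_n^{(k)}) z^n`; the sum is finite in each
coefficient. -/
def xi {ℓ : ℕ} (k : Fin ℓ) : Big ℓ :=
  fun m => ∑ᶠ n : ℕ+, MvPowerSeries.coeff m ((bx (k, n) - bx' (k, n)) * bz ^ (n : ℕ))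

/-- `e^{ξ(x^{(k)} - x'^{(k)}, z)}` -/
def expXi {ℓ : ℕ} (k : Fin ℓ) : Big ℓ := (PowerSeries.exp ℂ).subst (xi k)

/-- The `p`-th component of `[z⁻¹]^{(k)}`: it is `z^{-n} / n` for `p = (k, n)`, and `0` for
`p = (i, n)` with `i ≠ k`. -/
def zShift {ℓ : ℕ} (k : Fin ℓ) (p : Var ℓ) : Big ℓ :=
  if p.1 = k then (((p.2 : ℕ) : ℂ)⁻¹) • bw ^ (p.2 : ℕ) else 0

/-- `F(x - [z⁻¹]^{(k)})` -/
def shiftX {ℓ : ℕ} (k : Fin ℓ) (F : MvPowerSeries (Var ℓ) ℂ) : Big ℓ :=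
  F.subst fun p => bx p - zShift k p

/-- `G(x' + [z⁻¹]^{(k)})` -/
def shiftX' {ℓ : ℕ} (k : Fin ℓ) (G : MvPowerSeries (Var ℓ) ℂ) : Big ℓ :=
  G.subst fun p => bx' p + zShift k p

theorem coeff_zShift {ℓ : ℕ} (k : Fin ℓ) (p : Var ℓ) (m : BigVar ℓ →₀ ℕ)
    (h : MvPowerSeries.coeff m (zShift k p) ≠ 0) :
    p.1 = k ∧ m = Finsupp.single (Sum.inr 1) (p.2 : ℕ) := by
  classical
  rw [zShift] at h
  split_ifs at h with hk
  · refine ⟨hk, ?_⟩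
    by_contra hm
    apply h
    rw [MvPowerSeries.coeff_smul, bw, MvPowerSeries.coeff_X_pow, if_neg hm, mul_zero]
  · simp at h

theorem finite_zShift {ℓ : ℕ} (k : Fin ℓ) (m : BigVar ℓ →₀ ℕ) :
    {p : Var ℓ | MvPowerSeries.coeff m (zShift k p) ≠ 0}.Finite := by
  refine Set.Subsingleton.finite ?_
  intro p hp q hq
  obtain ⟨h1, h2⟩ := coeff_zShift k p m hp
  obtain ⟨h3, h4⟩ := coeff_zShift k q m hq
  have h5 := DFunLike.congr_fun (h2.symm.trans h4) (Sum.inr 1)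
  rw [Finsupp.single_eq_same, Finsupp.single_eq_same] at h5
  exact Prod.ext (h1.trans h3.symm) (PNat.coe_injective h5)

theorem finite_X {ℓ : ℕ} (f : Var ℓ → BigVar ℓ) (hf : Function.Injective f) (m : BigVar ℓ →₀ ℕ) :
    {p : Var ℓ | MvPowerSeries.coeff m (MvPowerSeries.X (f p) : Big ℓ) ≠ 0}.Finite := by
  classical
  refine Set.Subsingleton.finite ?_
  intro p hp q hq
  simp only [Set.mem_ofPred_eq, MvPowerSeries.coeff_X, ne_eq, ite_eq_right_iff, one_ne_zero,
    imp_false, not_not] at hp hq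
  exact hf ((Finsupp.single_left_inj one_ne_zero).1 (hp.symm.trans hq))

/-- The substitution `x ↦ x - [z⁻¹]^{(k)}` is defined on all formal power series. -/
theorem hasSubst_shiftX {ℓ : ℕ} (k : Fin ℓ) :
    MvPowerSeries.HasSubst fun p : Var ℓ => bx p - zShift k p where
  const_coeff p := by
    rw [map_sub, bx, MvPowerSeries.constantCoeff_X, zShift]
    split_ifs
    · simp [bw]
    · simp
  coeff_zero m := by
    refine ((finite_X (fun p => Sum.inl (Sum.inl p))
      (Sum.inl_injective.comp Sum.inl_injective) m).union (finite_zShift k m)).subset ?_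
    intro p hp
    by_contra hn
    simp only [Set.mem_union, Set.mem_ofPred_eq, not_or, not_not] at hn
    exact hp (by rw [map_sub, bx, hn.1, hn.2, sub_zero])

/-- The substitution `x' ↦ x' + [z⁻¹]^{(k)}` is defined on all formal power series. -/
theorem hasSubst_shiftX' {ℓ : ℕ} (k : Fin ℓ) :
    MvPowerSeries.HasSubst fun p : Var ℓ => bx' p + zShift k p where
  const_coeff p := by
    rw [map_add, bx', MvPowerSeries.constantCoeff_X, zShift]
    split_ifs
    · simp [bw]
    · simp
  coeff_zero m := by
    refine ((finite_X (fun p => Sum.inl (Sum.inr p))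
      (Sum.inl_injective.comp Sum.inr_injective) m).union (finite_zShift k m)).subset ?_
    intro p hp
    by_contra hn
    simp only [Set.mem_union, Set.mem_ofPred_eq, not_or, not_not] at hn
    exact hp (by rw [map_add, bx', hn.1, hn.2, add_zero])

/-- The weight of an exponent: `x_n` and `x'_n` have weight `n`, the letters `z` and `w` weight `0`. -/
def bigWeight {ℓ : ℕ} : (BigVar ℓ →₀ ℕ) →+ ℕ :=
  Finsupp.weight (Sum.elim (Sum.elim (fun p : Var ℓ => (p.2 : ℕ)) fun p => (p.2 : ℕ)) fun _ => 0)

/-- The power series all of whose monomials have `z`-degree at most their weight. -/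
def zBounded (ℓ : ℕ) : Submonoid (Big ℓ) where
  carrier := {H | ∀ m, MvPowerSeries.coeff m H ≠ 0 → m (Sum.inr 0) ≤ bigWeight m}
  one_mem' := by
    classical
    intro m hm
    rw [MvPowerSeries.coeff_one] at hm
    have : m = 0 := by
      by_contra h
      exact hm (if_neg h)
    simp [this]
  mul_mem' := by
    classical
    intro a b ha hb m hm
    rw [MvPowerSeries.coeff_mul] at hm
    obtain ⟨p, hp, hne⟩ := Finset.exists_ne_zero_of_sum_ne_zero hm
    have h1 := ha _ (left_ne_zero_of_mul hne)
    have h2 := hb _ (right_ne_zero_of_mul hne)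
    rw [← Finset.HasAntidiagonal.mem_antidiagonal.1 hp, map_add, Finsupp.add_apply]
    omega

theorem zBounded_X {ℓ : ℕ} (s : Var ℓ ⊕ Var ℓ) (m : BigVar ℓ →₀ ℕ)
    (h : MvPowerSeries.coeff m (MvPowerSeries.X (Sum.inl s) : Big ℓ) ≠ 0) :
    m (Sum.inr 0) = 0 := by
  classical
  rw [MvPowerSeries.coeff_X] at h
  have : m = Finsupp.single (Sum.inl s) 1 := by
    by_contra hn
    exact h (if_neg hn)
  simp [this]

theorem zBounded_zShift {ℓ : ℕ} (k : Fin ℓ) (p : Var ℓ) (m : BigVar ℓ →₀ ℕ)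
    (h : MvPowerSeries.coeff m (zShift k p) ≠ 0) : m (Sum.inr 0) = 0 := by
  rw [(coeff_zShift k p m h).2]
  simp

theorem shiftX_mem {ℓ : ℕ} (k : Fin ℓ) (F : MvPowerSeries (Var ℓ) ℂ) : shiftX k F ∈ zBounded ℓ := by
  intro m hm
  rw [shiftX, MvPowerSeries.coeff_subst (hasSubst_shiftX k)] at hm
  obtain ⟨d, hd⟩ := exists_term_ne_zero hm
  refine Submonoid.prod_mem (zBounded ℓ) (fun p _ => Submonoid.pow_mem _ ?_ _) m
    (right_ne_zero_of_smul hd)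
  intro m hm
  have : m (Sum.inr 0) = 0 := by
    by_cases h : MvPowerSeries.coeff m (bx p) = 0
    · refine zBounded_zShift k p m fun h' => hm ?_
      rw [map_sub, h, h', sub_zero]
    · exact zBounded_X _ m h
  omega

theorem shiftX'_mem {ℓ : ℕ} (k : Fin ℓ) (G : MvPowerSeries (Var ℓ) ℂ) : shiftX' k G ∈ zBounded ℓ := by
  intro m hm
  rw [shiftX', MvPowerSeries.coeff_subst (hasSubst_shiftX' k)] at hm
  obtain ⟨d, hd⟩ := exists_term_ne_zero hm
  refine Submonoid.prod_mem (zBounded ℓ) (fun p _ => Submonoid.pow_mem _ ?_ _) m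
    (right_ne_zero_of_smul hd)
  intro m hm
  have : m (Sum.inr 0) = 0 := by
    by_cases h : MvPowerSeries.coeff m (bx' p) = 0
    · refine zBounded_zShift k p m fun h' => hm ?_
      rw [map_add, h, h', add_zero]
    · exact zBounded_X _ m h
  omega

/-- The terms of `ξ(x^{(k)} - x'^{(k)}, z)`. -/
theorem coeff_xi_term {ℓ : ℕ} (k : Fin ℓ) (n : ℕ+) (m : BigVar ℓ →₀ ℕ)
    (h : MvPowerSeries.coeff m ((bx (k, n) - bx' (k, n)) * bz ^ (n : ℕ)) ≠ 0) :
    m (Sum.inr 0) = n ∧ bigWeight m = n := by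
  classical
  rw [MvPowerSeries.coeff_mul] at h
  obtain ⟨p, hp, hne⟩ := Finset.exists_ne_zero_of_sum_ne_zero h
  have h2 : p.2 = Finsupp.single (Sum.inr 0) (n : ℕ) := by
    by_contra hn
    refine right_ne_zero_of_mul hne ?_
    rw [bz, MvPowerSeries.coeff_X_pow, if_neg hn]
  have h1 : p.1 = Finsupp.single (Sum.inl (Sum.inl (k, n))) 1 ∨
      p.1 = Finsupp.single (Sum.inl (Sum.inr (k, n))) 1 := by
    by_contra hn
    rw [not_or] at hn
    refine left_ne_zero_of_mul hne ?_
    rw [map_sub, bx, bx', MvPowerSeries.coeff_X, MvPowerSeries.coeff_X, if_neg hn.1, if_neg hn.2,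
      sub_zero]
  rw [← Finset.HasAntidiagonal.mem_antidiagonal.1 hp, h2]
  rcases h1 with h1 | h1 <;> rw [h1] <;> simp [bigWeight, Finsupp.weight_single]

/-- The sum defining `ξ(x^{(k)} - x'^{(k)}, z)` is finite in each coefficient. -/
theorem xi_finite {ℓ : ℕ} (k : Fin ℓ) (m : BigVar ℓ →₀ ℕ) :
    (Function.support fun n : ℕ+ =>
      MvPowerSeries.coeff m ((bx (k, n) - bx' (k, n)) * bz ^ (n : ℕ))).Finite := by
  refine Set.Subsingleton.finite ?_
  intro a ha b hb
  exact PNat.coe_injective ((coeff_xi_term k a m ha).1.symm.trans (coeff_xi_term k b m hb).1)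

theorem xi_mem {ℓ : ℕ} (k : Fin ℓ) : xi k ∈ zBounded ℓ := by
  intro m hm
  obtain ⟨n, hn⟩ := exists_term_ne_zero
    (show ∑ᶠ n : ℕ+, MvPowerSeries.coeff m ((bx (k, n) - bx' (k, n)) * bz ^ (n : ℕ)) ≠ 0 from hm)
  obtain ⟨h1, h2⟩ := coeff_xi_term k n m hn
  omega

/-- The exponential of `ξ(x^{(k)} - x'^{(k)}, z)` is defined. -/
theorem hasSubst_xi {ℓ : ℕ} (k : Fin ℓ) : PowerSeries.HasSubst (xi k) := by
  refine PowerSeries.HasSubst.of_constantCoeff_zero ?_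
  by_contra h
  obtain ⟨n, hn⟩ := exists_term_ne_zero
    (show ∑ᶠ n : ℕ+, MvPowerSeries.coeff 0 ((bx (k, n) - bx' (k, n)) * bz ^ (n : ℕ)) ≠ 0 from h)
  have h1 := (coeff_xi_term k n 0 hn).1
  rw [Finsupp.zero_apply] at h1
  exact n.ne_zero h1.symm

theorem expXi_mem {ℓ : ℕ} (k : Fin ℓ) : expXi k ∈ zBounded ℓ := by
  intro m hm
  rw [expXi, PowerSeries.coeff_subst (hasSubst_xi k)] at hm
  obtain ⟨j, hj⟩ := exists_term_ne_zero hm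
  exact Submonoid.pow_mem _ (xi_mem k) j m (right_ne_zero_of_smul hj)

/-- The exponent of `x^d z^p w^q`, `d` being an exponent in `x` and `x'`. -/
def bigExp {ℓ : ℕ} (d : (Var ℓ ⊕ Var ℓ) →₀ ℕ) (p q : ℕ) : BigVar ℓ →₀ ℕ :=
  d.mapDomain Sum.inl + Finsupp.single (Sum.inr 0) p + Finsupp.single (Sum.inr 1) q

/-- `Res_z (z^a H|_{w = z⁻¹})`, a formal power series in `x` and `x'`: the sum of the coefficients
of `z^p w^q` in `H` over all `p`, `q` with `a + p - q = -1`. -/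
def residue {ℓ : ℕ} (a : ℤ) (H : Big ℓ) : MvPowerSeries (Var ℓ ⊕ Var ℓ) ℂ :=
  fun d => ∑ᶠ pq : {pq : ℕ × ℕ // a + pq.1 - pq.2 = -1},
    MvPowerSeries.coeff (bigExp d pq.1.1 pq.1.2) H

/-- `Res_z (z^a e^{ξ(x^{(k)} - x'^{(k)}, z)} F(x - [z⁻¹]^{(k)}) G(x' + [z⁻¹]^{(k)}))` -/
def hirotaRes {ℓ : ℕ} (k : Fin ℓ) (a : ℤ) (F G : MvPowerSeries (Var ℓ) ℂ) :
    MvPowerSeries (Var ℓ ⊕ Var ℓ) ℂ :=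
  residue a (expXi k * shiftX k F * shiftX' k G)

/-- The sum defining the residue in `hirotaRes` is finite in each coefficient. -/
theorem hirotaRes_finite {ℓ : ℕ} (k : Fin ℓ) (a : ℤ) (F G : MvPowerSeries (Var ℓ) ℂ)
    (d : (Var ℓ ⊕ Var ℓ) →₀ ℕ) :
    (Function.support fun pq : {pq : ℕ × ℕ // a + pq.1 - pq.2 = -1} =>
      MvPowerSeries.coeff (bigExp d pq.1.1 pq.1.2)
        (expXi k * shiftX k F * shiftX' k G)).Finite := by
  have hmem := (zBounded ℓ).mul_mem ((zBounded ℓ).mul_mem (expXi_mem k) (shiftX_mem k F))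
    (shiftX'_mem k G)
  refine Set.Finite.of_injOn (f := fun pq => pq.1.1)
    (t := {p : ℕ | p ≤ bigWeight (d.mapDomain Sum.inl : BigVar ℓ →₀ ℕ)}) ?_ ?_ (Set.finite_le_nat _)
  · rintro ⟨⟨p, q⟩, h⟩ hpq
    have h1 := hmem _ hpq
    have h2 : (d.mapDomain Sum.inl : BigVar ℓ →₀ ℕ) (Sum.inr 0) = 0 :=
      Finsupp.mapDomain_of_notMem_range _ _ (by simp)
    have h3 : bigWeight (Finsupp.single (Sum.inr 0) p : BigVar ℓ →₀ ℕ) = 0 := by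
      simp [bigWeight, Finsupp.weight_single]
    have h4 : bigWeight (Finsupp.single (Sum.inr 1) q : BigVar ℓ →₀ ℕ) = 0 := by
      simp [bigWeight, Finsupp.weight_single]
    simp only [bigExp, map_add, Finsupp.add_apply, h2, h3, h4, Finsupp.single_eq_same] at h1
    simp only [Set.mem_ofPred_eq]
    omega
  · rintro ⟨⟨p, q⟩, h⟩ _ ⟨⟨p', q'⟩, h'⟩ _ e
    simp only at e h h'
    subst e
    have : q = q' := by omega
    subst this
    rfl

/-- The Kronecker delta. -/
def kron {ℓ : ℕ} (i j : Fin ℓ) : ℤ := if i = j then 1 else 0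

/-- The Hirota bilinear equations associated to `𝔤`. -/
def HirotaEquations {ℓ : ℕ} (τ : Q ℓ → MvPowerSeries (Var ℓ) ℂ) : Prop :=
  ∀ (m : ℕ), ∀ α ∈ rootLattice ℓ, ∀ β ∈ rootLattice ℓ, ∀ i j : Fin ℓ,
    ∑ k, epsC (v k) (α - β + v i + v j) •
      hirotaRes k (form (v k) (α - β) + m - 2 + kron i k + kron j k)
        (τ (α + v i - v k)) (τ (β - v j + v k)) = 0

/-- The index `ℓ` in `{1, …, ℓ}`. -/
def lastIdx (ℓ : ℕ) [NeZero ℓ] : Fin ℓ := ⟨ℓ - 1, Nat.sub_lt (NeZero.pos ℓ) one_pos⟩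

/-- The bilinear form of the `(λ_1, …, λ_ℓ)`-reduction of the `ℓ`-component KP hierarchy. The
equations with `m = 0` are those of the `ℓ`-component KP hierarchy itself. -/
def ReducedKP {ℓ : ℕ} [NeZero ℓ] (lam : Fin ℓ → ℕ) (τ : Q ℓ → MvPowerSeries (Var ℓ) ℂ) : Prop :=
  ∀ (m : ℕ), ∀ α ∈ rootLattice ℓ, ∀ β ∈ rootLattice ℓ,
    ∑ k, epsC (v k) (α + β) •
      hirotaRes k (form (v k) (α - β) + m * lam k - 2 + 2 * kron k (lastIdx ℓ))
        (τ (α + v (lastIdx ℓ) - v k)) (τ (β - v (lastIdx ℓ) + v k)) = 0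

end LatticeVA

end

/-!
Write `E^α(z) = ∑ (e^α)_{(m)} z^{-m-1}`. The Hirota equations express the invariance of the bilinear
operator `Ω_m = ∑_k Res_z z^m E^{v_k}(z) ⊗ E^{-v_k}(z)` on `V_Q ⊗ V_Q` (`casimir`) under the affine
Lie algebra.

For `m ≥ 0` it kills `|0⟩ ⊗ |0⟩` (`casimir_vac`), since both factors of
`E^{v_k}(z)|0⟩ ⊗ E^{-v_k}(z)|0⟩` contain only nonnegative powers of `z`. It commutes with
`X ⊗ 1 + 1 ⊗ X` for `X ∈ 𝔤` (`commute_casimir`): a Heisenberg operator `h_{(n)}` multiplies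
`E^{±v_k}(z)` by `±(h | v_k) z^n`, and `e^{v_k - v_l}` turns `E^{v_l}` into a multiple of `E^{v_k}`
and `E^{-v_k}` into the opposite multiple of `E^{-v_l}`, so that the two contributions cancel. Hence
`Ω_m` kills every homogeneous part in `X` of `e^X|0⟩ ⊗ e^X|0⟩` (`casimir_sum_antidiagonal`).

The commutators of vertex operators needed here are those of `E^α` and `E^β` with
`(α | β) ∈ {0, 1, -1}`. Both sides of each exchange relation have the same commutators with the
creation operators, so it is enough to compare them on `1` (`vertexS_exchange`), where they become
identities between Schur polynomials.

The same principle identifies `Ω_m` with the Hirota expressions: as bilinear maps of polynomials,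
`Res_z z^a e^{ξ(x - x', z)} F(x - [z⁻¹]) G(x' + [z⁻¹])` and the product of the vertex operators of
`v_k` and `-v_k` have the same commutators with the variables, so it is enough to compare them on
`(1, 1)` (`hirotaBilin_eq_vertexBilin`, `tauProduct_casimir`).

Each coefficient of a Hirota expression is a finite bilinear combination of coefficients of the two
tau functions. The absolutely convergent series for these may therefore be multiplied out and
regrouped by the total degree in `X`, and every group vanishes (`hirotaEquations_of_isVacuumTau`).

The equivalence with the reduced hierarchy is a change of the indices `α` and `β`
(`hirotaEquations_iff_reducedKP`).
-/

open scoped Nat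

noncomputable section

namespace LatticeVA

/-! ### Exponentials of power series -/

section Coefficients

variable {A : Type*} [Ring A]

theorem commute_of_coeff {f g : PowerSeries A}
    (h : ∀ a b, Commute (PowerSeries.coeff a f) (PowerSeries.coeff b g)) : Commute f g := by
  ext n
  rw [PowerSeries.coeff_mul, PowerSeries.coeff_mul, ← Finset.Nat.sum_antidiagonal_swap]
  exact Finset.sum_congr rfl fun p _ => h _ _

/-- The coefficients of a power series, indexed by `ℤ`. -/
def zcoeff (k : ℤ) (f : PowerSeries A) : A :=
  match k with
  | Int.ofNat n => PowerSeries.coeff n f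
  | Int.negSucc _ => 0

theorem zcoeff_natCast (n : ℕ) (f : PowerSeries A) : zcoeff (n : ℤ) f = PowerSeries.coeff n f := rfl

theorem zcoeff_of_neg {k : ℤ} (hk : k < 0) (f : PowerSeries A) : zcoeff k f = 0 := by
  obtain ⟨n, rfl⟩ := Int.eq_negSucc_of_lt_zero hk
  rfl

theorem coeff_pow_of_lt {f : PowerSeries A} (hf : PowerSeries.constantCoeff f = 0) {j k : ℕ}
    (h : k < j) : PowerSeries.coeff k (f ^ j) = 0 := by
  induction j generalizing k with
  | zero => omega
  | succ j ih =>
    rw [pow_succ, PowerSeries.coeff_mul]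
    refine Finset.sum_eq_zero fun p hp => ?_
    have hp' := Finset.HasAntidiagonal.mem_antidiagonal.1 hp
    rcases Nat.eq_zero_or_pos p.2 with h1 | h1
    · rw [h1, PowerSeries.coeff_zero_eq_constantCoeff_apply, hf, mul_zero]
    · rw [ih (by omega), zero_mul]

end Coefficients

section ExpSeries

variable {A B : Type*} [Ring A] [Algebra ℂ A] [Ring B] [Algebra ℂ B]

/-- The Euler derivation `z d/dz` of power series. -/
def euler (f : PowerSeries A) : PowerSeries A :=
  PowerSeries.mk fun n => (n : ℂ) • PowerSeries.coeff n f

theorem coeff_euler (n : ℕ) (f : PowerSeries A) :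
    PowerSeries.coeff n (euler f) = (n : ℂ) • PowerSeries.coeff n f :=
  PowerSeries.coeff_mk _ _

theorem euler_add (f g : PowerSeries A) : euler (f + g) = euler f + euler g := by
  ext n
  simp only [coeff_euler, map_add, smul_add]

theorem euler_sub (f g : PowerSeries A) : euler (f - g) = euler f - euler g := by
  ext n
  simp only [coeff_euler, map_sub, smul_sub]

theorem euler_smul (c : ℂ) (f : PowerSeries A) : euler (c • f) = c • euler f := by
  ext n
  rw [coeff_euler, PowerSeries.coeff_smul, PowerSeries.coeff_smul, coeff_euler, smul_comm]

theorem euler_mul (f g : PowerSeries A) : euler (f * g) = euler f * g + f * euler g := by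
  ext n
  simp only [coeff_euler, map_add, PowerSeries.coeff_mul, Finset.smul_sum,
    ← Finset.sum_add_distrib]
  refine Finset.sum_congr rfl fun p hp => ?_
  rw [← Finset.HasAntidiagonal.mem_antidiagonal.1 hp, Nat.cast_add, add_smul,
    smul_mul_assoc, mul_smul_comm]

theorem euler_C (a : A) : euler (PowerSeries.C a) = 0 := by
  ext n
  rw [coeff_euler, PowerSeries.coeff_C]
  split_ifs with h <;> simp [h]

theorem euler_one : euler (1 : PowerSeries A) = 0 := by
  rw [← map_one PowerSeries.C, euler_C]

theorem euler_X_pow (n : ℕ) : euler (PowerSeries.X ^ n : PowerSeries A) =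
    (n : ℂ) • PowerSeries.X ^ n := by
  ext k
  rw [coeff_euler, PowerSeries.coeff_smul, PowerSeries.coeff_X_pow]
  split_ifs with h <;> simp [h]

/-- A linear differential equation `z g' = F g` with `F(0) = 0` has at most one solution with a
given constant term. -/
theorem eq_of_euler_eq_mul {F g h : PowerSeries A} (hF : PowerSeries.constantCoeff F = 0)
    (hg : euler g = F * g) (hh : euler h = F * h)
    (h0 : PowerSeries.constantCoeff g = PowerSeries.constantCoeff h) : g = h := by
  ext n
  induction n using Nat.strong_induction_on with
  | _ n ih =>
    rcases Nat.eq_zero_or_pos n with rfl | hn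
    · simpa using h0
    · have e1 := congrArg (PowerSeries.coeff n) hg
      have e2 := congrArg (PowerSeries.coeff n) hh
      rw [coeff_euler, PowerSeries.coeff_mul] at e1 e2
      have : ∑ p ∈ Finset.HasAntidiagonal.antidiagonal n,
          PowerSeries.coeff p.1 F * PowerSeries.coeff p.2 g =
          ∑ p ∈ Finset.HasAntidiagonal.antidiagonal n,
            PowerSeries.coeff p.1 F * PowerSeries.coeff p.2 h := by
        refine Finset.sum_congr rfl fun p hp => ?_
        have hp' := Finset.HasAntidiagonal.mem_antidiagonal.1 hp
        rcases Nat.eq_zero_or_pos p.1 with h1 | h1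
        · rw [h1, PowerSeries.coeff_zero_eq_constantCoeff_apply, hF, zero_mul, zero_mul]
        · rw [ih p.2 (by omega)]
      rw [this, ← e2] at e1
      exact smul_right_injective A (by exact_mod_cast hn.ne' : (n : ℂ) ≠ 0) e1

/-- The exponential may be truncated anywhere beyond the order of the coefficient. -/
theorem coeff_expSeries {f : PowerSeries A} (hf : PowerSeries.constantCoeff f = 0) {k N : ℕ}
    (h : k < N) : PowerSeries.coeff k (expSeries f) =
      PowerSeries.coeff k (∑ j ∈ Finset.range N, ((j ! : ℕ) : ℂ)⁻¹ • f ^ j) := by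
  rw [expSeries, PowerSeries.coeff_mk, map_sum]
  simp only [PowerSeries.coeff_smul]
  refine Finset.sum_subset (Finset.range_subset_range.2 h) fun j _ hj => ?_
  rw [coeff_pow_of_lt hf (by simpa using hj), smul_zero]

theorem constantCoeff_expSeries (f : PowerSeries A) :
    PowerSeries.constantCoeff (expSeries f) = 1 := by
  rw [← PowerSeries.coeff_zero_eq_constantCoeff_apply, expSeries, PowerSeries.coeff_mk]
  simp

theorem euler_pow_succ {f : PowerSeries A} (hf : Commute f (euler f)) (j : ℕ) :
    euler (f ^ (j + 1)) = ((j + 1 : ℕ) : ℂ) • (euler f * f ^ j) := by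
  induction j with
  | zero => simp
  | succ j ih =>
    rw [pow_succ, euler_mul, ih, (hf.pow_left (j + 1)).eq, smul_mul_assoc, mul_assoc, ← pow_succ]
    push_cast
    module

/-- `z d/dz exp f = (z f') exp f`, if the coefficients of `f` commute. -/
theorem euler_expSeries {f : PowerSeries A} (hf : PowerSeries.constantCoeff f = 0)
    (hc : ∀ a b, Commute (PowerSeries.coeff a f) (PowerSeries.coeff b f)) :
    euler (expSeries f) = euler f * expSeries f := by
  have hcomm : Commute f (euler f) := commute_of_coeff fun a b => by
    rw [coeff_euler]
    exact (hc a b).smul_right _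
  ext n
  have h1 : euler (∑ j ∈ Finset.range (n + 1 + 1), ((j ! : ℕ) : ℂ)⁻¹ • f ^ j) =
      euler f * ∑ j ∈ Finset.range (n + 1), ((j ! : ℕ) : ℂ)⁻¹ • f ^ j := by
    have hs : ∀ s : Finset ℕ, euler (∑ j ∈ s, ((j ! : ℕ) : ℂ)⁻¹ • f ^ j) =
        ∑ j ∈ s, ((j ! : ℕ) : ℂ)⁻¹ • euler (f ^ j) := by
      intro s
      ext k
      simp only [coeff_euler, map_sum, PowerSeries.coeff_smul, Finset.smul_sum, smul_comm (k : ℂ)]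
    rw [hs, Finset.sum_range_succ', Finset.mul_sum, pow_zero, euler_one, smul_zero, add_zero]
    refine Finset.sum_congr rfl fun j _ => ?_
    rw [euler_pow_succ hcomm, smul_smul, mul_smul_comm, Nat.factorial_succ]
    congr 1
    have h1 : ((j + 1 : ℕ) : ℂ) ≠ 0 := by exact_mod_cast j.succ_ne_zero
    have h2 : ((j ! : ℕ) : ℂ) ≠ 0 := by exact_mod_cast j.factorial_ne_zero
    push_cast at h1 ⊢
    field_simp
  rw [coeff_euler, coeff_expSeries hf (show n < n + 1 + 1 by omega), ← coeff_euler, h1,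
    PowerSeries.coeff_mul, PowerSeries.coeff_mul]
  refine Finset.sum_congr rfl fun p hp => ?_
  have hp' := Finset.HasAntidiagonal.mem_antidiagonal.1 hp
  rw [coeff_expSeries hf (show p.2 < n + 1 by omega)]

theorem constantCoeff_euler (f : PowerSeries A) : PowerSeries.constantCoeff (euler f) = 0 := by
  rw [← PowerSeries.coeff_zero_eq_constantCoeff_apply, coeff_euler, Nat.cast_zero, zero_smul]

theorem map_expSeries (F : A →ₐ[ℂ] B) (f : PowerSeries A) :
    PowerSeries.map (F : A →+* B) (expSeries f) = expSeries (PowerSeries.map (F : A →+* B) f) := by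
  ext n
  simp only [expSeries, PowerSeries.coeff_map, PowerSeries.coeff_mk, ← map_pow]
  simp

/-- If `ad M` maps `f` to `c z^n`, then it maps `exp f` to `c z^n exp f`. -/
theorem C_mul_expSeries {f : PowerSeries A} (hf : PowerSeries.constantCoeff f = 0)
    (hc : ∀ a b, Commute (PowerSeries.coeff a f) (PowerSeries.coeff b f)) (M : A) (c : ℂ) {n : ℕ}
    (hn : 0 < n)
    (hM : PowerSeries.C M * f = f * PowerSeries.C M + c • PowerSeries.X ^ n) :
    PowerSeries.C M * expSeries f =
      expSeries f * PowerSeries.C M + c • (PowerSeries.X ^ n * expSeries f) := by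
  set E := expSeries f with hE
  have hEe : euler E = euler f * E := euler_expSeries hf hc
  have hXc : ∀ g : PowerSeries A, PowerSeries.X ^ n * g = g * PowerSeries.X ^ n := fun g =>
    ((PowerSeries.commute_X_pow g n).eq).symm
  have hM' := congrArg euler hM
  rw [euler_add, euler_mul, euler_mul, euler_smul, euler_X_pow, euler_C, zero_mul, zero_add,
    mul_zero, add_zero] at hM'
  rw [← sub_eq_zero, ← sub_sub]
  refine eq_of_euler_eq_mul (F := euler f) (constantCoeff_euler f) ?_ ?_ ?_
  · simp only [euler_sub, euler_mul, euler_smul, euler_X_pow, euler_C, hEe]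
    rw [zero_mul, zero_add, mul_zero, add_zero, ← mul_assoc, hM', mul_sub, mul_sub,
      mul_smul_comm, ← mul_assoc, ← mul_assoc, ← mul_assoc, hXc (euler f)]
    simp only [add_mul, smul_mul_assoc, mul_assoc, smul_add]
    abel
  · ext k
    simp [coeff_euler]
  · rw [map_zero, map_sub, map_sub, map_mul, map_mul, hE, constantCoeff_expSeries]
    rw [← PowerSeries.coeff_zero_eq_constantCoeff_apply (c • _), PowerSeries.coeff_smul, hXc,
      PowerSeries.coeff_mul_X_pow', if_neg (by omega)]
    simp

theorem mul_zcoeff_expSeries {f : PowerSeries A} (hf : PowerSeries.constantCoeff f = 0)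
    (hc : ∀ a b, Commute (PowerSeries.coeff a f) (PowerSeries.coeff b f)) (M : A) (c : ℂ) {n : ℕ}
    (hn : 0 < n)
    (hM : ∀ a, M * PowerSeries.coeff a f =
      PowerSeries.coeff a f * M + c • (if a = n then 1 else 0)) (k : ℤ) :
    M * zcoeff k (expSeries f) =
      zcoeff k (expSeries f) * M + c • zcoeff (k - n) (expSeries f) := by
  rcases lt_or_ge k 0 with hk | hk
  · rw [zcoeff_of_neg hk, zcoeff_of_neg (by omega)]
    simp
  · lift k to ℕ using hk
    have h := C_mul_expSeries hf hc M c hn (by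
      ext a
      rw [PowerSeries.coeff_C_mul, map_add, PowerSeries.coeff_mul_C, PowerSeries.coeff_smul,
        PowerSeries.coeff_X_pow, hM a])
    have h2 := congrArg (PowerSeries.coeff k) h
    rw [PowerSeries.coeff_C_mul, map_add, PowerSeries.coeff_mul_C, PowerSeries.coeff_smul,
      ← (PowerSeries.commute_X_pow _ n).eq, PowerSeries.coeff_mul_X_pow'] at h2
    rw [zcoeff_natCast, h2]
    congr 2
    split_ifs with hkn
    · rw [← Nat.cast_sub hkn, zcoeff_natCast]
    · rw [zcoeff_of_neg (by omega)]

end ExpSeries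

theorem expSeries_add {A : Type*} [CommRing A] [Algebra ℂ A] {f g : PowerSeries A}
    (hf : PowerSeries.constantCoeff f = 0) (hg : PowerSeries.constantCoeff g = 0) :
    expSeries (f + g) = expSeries f * expSeries g := by
  have hfg : PowerSeries.constantCoeff (f + g) = 0 := by rw [map_add, hf, hg, add_zero]
  refine eq_of_euler_eq_mul (F := euler (f + g)) (constantCoeff_euler _) ?_ ?_ ?_
  · exact euler_expSeries hfg fun a b => Commute.all _ _
  · rw [euler_mul, euler_expSeries hf fun a b => Commute.all _ _,
      euler_expSeries hg fun a b => Commute.all _ _, euler_add]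
    ring
  · rw [map_mul, constantCoeff_expSeries, constantCoeff_expSeries, constantCoeff_expSeries, one_mul]

/-! ### The Heisenberg algebra and vertex operators on the symmetric algebra -/

/-- The pairing `(h | α)` of `h ∈ 𝔥` and `α ∈ Q`. -/
def dot {ℓ : ℕ} (h : Fin ℓ → ℂ) (α : Q ℓ) : ℂ := ∑ i, h i * (α i : ℂ)

theorem dot_toH {ℓ : ℕ} (α β : Q ℓ) : dot (toH α) β = form α β := by
  simp [dot, toH, form]

theorem heisNeg_apply {ℓ : ℕ} (h : Fin ℓ → ℂ) (n : ℕ+) (g : SymAlg ℓ) :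
    heisNeg h n g = (∑ i, h i • (MvPolynomial.X (i, n) : SymAlg ℓ)) * g := rfl

theorem heisPos_apply {ℓ : ℕ} (h : Fin ℓ → ℂ) (n : ℕ+) (g : SymAlg ℓ) :
    heisPos h n g = ∑ i, (h i * ((n : ℕ) : ℂ)) • MvPolynomial.pderiv (i, n) g := by
  simp [heisPos]

theorem heisPos_one {ℓ : ℕ} (h : Fin ℓ → ℂ) (n : ℕ+) : heisPos h n 1 = 0 := by
  simp [heisPos_apply]

theorem heisPos_mul {ℓ : ℕ} (h : Fin ℓ → ℂ) (n : ℕ+) (f g : SymAlg ℓ) :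
    heisPos h n (f * g) = heisPos h n f * g + f * heisPos h n g := by
  simp only [heisPos_apply, Finset.sum_mul, Finset.mul_sum, ← Finset.sum_add_distrib]
  refine Finset.sum_congr rfl fun i _ => ?_
  rw [MvPolynomial.pderiv_mul, smul_add, smul_mul_assoc, mul_smul_comm]

theorem heisPos_X {ℓ : ℕ} (h : Fin ℓ → ℂ) (n : ℕ+) (i : Fin ℓ) (m : ℕ+) :
    heisPos h n (MvPolynomial.X (i, m)) = if m = n then MvPolynomial.C (h i * ((n : ℕ) : ℂ))
      else 0 := by
  classical
  rw [heisPos_apply]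
  split_ifs with hmn
  · subst hmn
    rw [Finset.sum_eq_single i]
    · rw [MvPolynomial.pderiv_X_self, MvPolynomial.smul_eq_C_mul, mul_one]
    · intro j _ hj
      rw [MvPolynomial.pderiv_X_of_ne (by simpa using Ne.symm hj), smul_zero]
    · simp
  · refine Finset.sum_eq_zero fun j _ => ?_
    rw [MvPolynomial.pderiv_X_of_ne (by simp [hmn]), smul_zero]

/-- The Heisenberg relation `[h_{(n)}, h'_{(-m)}] = n δ_{n,m} (h | h')`. -/
theorem heisPos_mul_heisNeg {ℓ : ℕ} (h h' : Fin ℓ → ℂ) (n m : ℕ+) :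
    heisPos h n * heisNeg h' m = heisNeg h' m * heisPos h n +
      (if m = n then ((n : ℕ) : ℂ) * ∑ i, h i * h' i else 0) • 1 := by
  refine LinearMap.ext fun g => ?_
  simp only [Module.End.mul_apply, LinearMap.add_apply, LinearMap.smul_apply, Module.End.one_apply,
    heisNeg_apply, heisPos_mul]
  rw [add_comm, map_sum]
  congr 1
  simp only [map_smul, heisPos_X]
  split_ifs with hmn
  · rw [MvPolynomial.smul_eq_C_mul, Finset.mul_sum, map_sum]
    congr 1
    refine Finset.sum_congr rfl fun i _ => ?_
    rw [MvPolynomial.smul_eq_C_mul, ← map_mul]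
    congr 1
    ring
  · simp

theorem pderiv_comm {σ : Type*} (s t : σ) (g : MvPolynomial σ ℂ) :
    MvPolynomial.pderiv s (MvPolynomial.pderiv t g) =
      MvPolynomial.pderiv t (MvPolynomial.pderiv s g) := by
  classical
  have h : ⁅MvPolynomial.pderiv (R := ℂ) s, MvPolynomial.pderiv (R := ℂ) t⁆ = 0 := by
    refine MvPolynomial.derivation_ext fun i => ?_
    rw [Derivation.commutator_apply, MvPolynomial.pderiv_X, MvPolynomial.pderiv_X]
    by_cases h1 : i = s <;> by_cases h2 : i = t <;> simp [h1, h2, Pi.single_apply] <;>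
      split_ifs <;> simp
  have h2 := DFunLike.congr_fun h g
  rw [Derivation.commutator_apply] at h2
  exact sub_eq_zero.1 h2

theorem heisPos_commute {ℓ : ℕ} (h h' : Fin ℓ → ℂ) (n m : ℕ+) :
    Commute (heisPos h n) (heisPos h' m) := by
  refine LinearMap.ext fun g => ?_
  simp only [Module.End.mul_apply, heisPos_apply, map_sum, map_smul, Finset.smul_sum]
  rw [Finset.sum_comm]
  refine Finset.sum_congr rfl fun i _ => Finset.sum_congr rfl fun j _ => ?_
  rw [smul_comm, pderiv_comm]

theorem heisNeg_commute {ℓ : ℕ} (h h' : Fin ℓ → ℂ) (n m : ℕ+) :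
    Commute (heisNeg h n) (heisNeg h' m) := by
  refine LinearMap.ext fun g => ?_
  simp only [Module.End.mul_apply, heisNeg_apply]
  ring

/-- The exponent `∑_{n>0} α_{(-n)} z^n / n` of `gammaPlus`. -/
def logPlus {ℓ : ℕ} (α : Q ℓ) : PowerSeries (Module.End ℂ (SymAlg ℓ)) :=
  PowerSeries.mk fun n => if hn : 0 < n then (n : ℂ)⁻¹ • heisNeg (toH α) ⟨n, hn⟩ else 0

/-- The exponent `- ∑_{n>0} α_{(n)} z^{-n} / n` of `gammaMinus`. -/
def logMinus {ℓ : ℕ} (α : Q ℓ) : PowerSeries (Module.End ℂ (SymAlg ℓ)) :=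
  PowerSeries.mk fun n => if hn : 0 < n then -(n : ℂ)⁻¹ • heisPos (toH α) ⟨n, hn⟩ else 0

theorem coeff_logPlus {ℓ : ℕ} (α : Q ℓ) (n : ℕ+) :
    PowerSeries.coeff (n : ℕ) (logPlus α) = ((n : ℕ) : ℂ)⁻¹ • heisNeg (toH α) n := by
  rw [logPlus, PowerSeries.coeff_mk, dif_pos n.pos]
  rfl

theorem coeff_logMinus {ℓ : ℕ} (α : Q ℓ) (n : ℕ+) :
    PowerSeries.coeff (n : ℕ) (logMinus α) = -((n : ℕ) : ℂ)⁻¹ • heisPos (toH α) n := by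
  rw [logMinus, PowerSeries.coeff_mk, dif_pos n.pos]
  rfl

theorem constantCoeff_logPlus {ℓ : ℕ} (α : Q ℓ) : PowerSeries.constantCoeff (logPlus α) = 0 := by
  rw [← PowerSeries.coeff_zero_eq_constantCoeff_apply, logPlus, PowerSeries.coeff_mk,
    dif_neg (lt_irrefl 0)]

theorem constantCoeff_logMinus {ℓ : ℕ} (α : Q ℓ) : PowerSeries.constantCoeff (logMinus α) = 0 := by
  rw [← PowerSeries.coeff_zero_eq_constantCoeff_apply, logMinus, PowerSeries.coeff_mk,
    dif_neg (lt_irrefl 0)]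

theorem commute_coeff_logPlus {ℓ : ℕ} (α : Q ℓ) {M : Module.End ℂ (SymAlg ℓ)}
    (hM : ∀ n, Commute M (heisNeg (toH α) n)) (a : ℕ) :
    Commute M (PowerSeries.coeff a (logPlus α)) := by
  rcases Nat.eq_zero_or_pos a with rfl | ha
  · rw [PowerSeries.coeff_zero_eq_constantCoeff_apply, constantCoeff_logPlus]
    exact Commute.zero_right _
  · lift a to ℕ+ using ha
    rw [coeff_logPlus]
    exact (hM a).smul_right _

theorem commute_coeff_logMinus {ℓ : ℕ} (α : Q ℓ) {M : Module.End ℂ (SymAlg ℓ)}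
    (hM : ∀ n, Commute M (heisPos (toH α) n)) (a : ℕ) :
    Commute M (PowerSeries.coeff a (logMinus α)) := by
  rcases Nat.eq_zero_or_pos a with rfl | ha
  · rw [PowerSeries.coeff_zero_eq_constantCoeff_apply, constantCoeff_logMinus]
    exact Commute.zero_right _
  · lift a to ℕ+ using ha
    rw [coeff_logMinus]
    exact (hM a).smul_right _

theorem commute_logPlus {ℓ : ℕ} (α : Q ℓ) (a b : ℕ) :
    Commute (PowerSeries.coeff a (logPlus α)) (PowerSeries.coeff b (logPlus α)) :=
  commute_coeff_logPlus α (fun _ =>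
    (commute_coeff_logPlus α (fun _ => heisNeg_commute _ _ _ _) a).symm) b

theorem commute_logMinus {ℓ : ℕ} (α : Q ℓ) (a b : ℕ) :
    Commute (PowerSeries.coeff a (logMinus α)) (PowerSeries.coeff b (logMinus α)) :=
  commute_coeff_logMinus α (fun _ =>
    (commute_coeff_logMinus α (fun _ => heisPos_commute _ _ _ _) a).symm) b

/-- The coefficient of `z^k` in `gammaPlus`. -/
def gp {ℓ : ℕ} (α : Q ℓ) (k : ℤ) : Module.End ℂ (SymAlg ℓ) := zcoeff k (gammaPlus α)

/-- The coefficient of `z^{-k}` in `gammaMinus`. -/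
def gm {ℓ : ℕ} (α : Q ℓ) (k : ℤ) : Module.End ℂ (SymAlg ℓ) := zcoeff k (gammaMinus α)

theorem heisPos_mul_gp {ℓ : ℕ} (h : Fin ℓ → ℂ) (n : ℕ+) (α : Q ℓ) (k : ℤ) :
    heisPos h n * gp α k = gp α k * heisPos h n + dot h α • gp α (k - (n : ℕ)) := by
  refine mul_zcoeff_expSeries (constantCoeff_logPlus α) (commute_logPlus α) _ _ n.pos
    (fun a => ?_) k
  rcases Nat.eq_zero_or_pos a with rfl | ha
  · rw [PowerSeries.coeff_zero_eq_constantCoeff_apply, constantCoeff_logPlus, if_neg n.ne_zero.symm]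
    simp
  · lift a to ℕ+ using ha
    simp only [coeff_logPlus, PNat.coe_inj]
    rw [mul_smul_comm, heisPos_mul_heisNeg, smul_add, smul_mul_assoc]
    congr 1
    split_ifs with hn
    · subst hn
      rw [smul_smul, inv_mul_cancel_left₀ (by exact_mod_cast a.ne_zero)]
      rfl
    · simp

theorem heisNeg_mul_gp {ℓ : ℕ} (h : Fin ℓ → ℂ) (n : ℕ+) (α : Q ℓ) (k : ℤ) :
    heisNeg h n * gp α k = gp α k * heisNeg h n + (0 : ℂ) • gp α (k - (n : ℕ)) := by
  refine mul_zcoeff_expSeries (constantCoeff_logPlus α) (commute_logPlus α) _ _ n.pos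
    (fun a => ?_) k
  rw [zero_smul, add_zero]
  exact commute_coeff_logPlus α (fun _ => heisNeg_commute _ _ _ _) a

theorem heisPos_mul_gm {ℓ : ℕ} (h : Fin ℓ → ℂ) (n : ℕ+) (α : Q ℓ) (k : ℤ) :
    heisPos h n * gm α k = gm α k * heisPos h n + (0 : ℂ) • gm α (k - (n : ℕ)) := by
  refine mul_zcoeff_expSeries (constantCoeff_logMinus α) (commute_logMinus α) _ _ n.pos
    (fun a => ?_) k
  rw [zero_smul, add_zero]
  exact commute_coeff_logMinus α (fun _ => heisPos_commute _ _ _ _) a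

theorem heisNeg_mul_gm {ℓ : ℕ} (h : Fin ℓ → ℂ) (n : ℕ+) (α : Q ℓ) (k : ℤ) :
    heisNeg h n * gm α k = gm α k * heisNeg h n + dot h α • gm α (k - (n : ℕ)) := by
  refine mul_zcoeff_expSeries (constantCoeff_logMinus α) (commute_logMinus α) _ _ n.pos
    (fun a => ?_) k
  rcases Nat.eq_zero_or_pos a with rfl | ha
  · rw [PowerSeries.coeff_zero_eq_constantCoeff_apply, constantCoeff_logMinus,
      if_neg n.ne_zero.symm]
    simp
  · lift a to ℕ+ using ha
    simp only [coeff_logMinus, PNat.coe_inj]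
    rw [smul_mul_assoc, heisPos_mul_heisNeg, smul_add, mul_smul_comm, add_assoc, left_eq_add]
    by_cases hn : a = n
    · subst hn
      have e : ∑ i, toH α i * h i = dot h α := by simp [dot, toH, mul_comm]
      rw [if_pos rfl, if_pos rfl, smul_smul, neg_mul,
        inv_mul_cancel_left₀ (by exact_mod_cast a.ne_zero), e, neg_smul, neg_add_cancel]
    · rw [if_neg hn, if_neg (Ne.symm hn)]
      simp

theorem gm_finite {ℓ : ℕ} (α : Q ℓ) (g : SymAlg ℓ) : {q : ℤ | gm α q g ≠ 0}.Finite := by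
  obtain ⟨W, hW⟩ := exists_mem_filt g
  refine (Set.finite_Icc 0 W).subset fun q hq => ?_
  have h0 : 0 ≤ q := by
    by_contra h
    exact hq (by rw [gm, zcoeff_of_neg (by omega)]; rfl)
  lift q to ℕ using h0
  refine ⟨by omega, ?_⟩
  by_contra h
  exact hq (filt_neg (by omega) (gammaMinus_mem_filt α q W g hW))

theorem gp_gm_finite {ℓ : ℕ} (α : Q ℓ) (u : ℤ → ℤ) (g : SymAlg ℓ) :
    (Function.support fun q : ℤ => gp α (u q) (gm α q g)).Finite :=
  (gm_finite α g).subset fun q hq h => hq (by simp only [h, map_zero])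

theorem finsum_comp_of_support_subset {ι κ M : Type*} [AddCommMonoid M] {e : ι → κ}
    (he : Function.Injective e) {f : κ → M} (hf : Function.support f ⊆ Set.range e) :
    ∑ᶠ i, f (e i) = ∑ᶠ j, f j := by
  classical
  rw [← finsum_mem_range he]
  refine finsum_congr fun j => ?_
  by_cases hj : j ∈ Set.range e
  · rw [finsum_eq_if, if_pos hj]
  · rw [finsum_eq_if, if_neg hj]
    by_contra h
    exact hj (hf (Ne.symm h))

theorem vertexS_apply {ℓ : ℕ} (α : Q ℓ) (k : ℤ) (g : SymAlg ℓ) :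
    vertexS α k g = ∑ᶠ q : ℤ, gp α (k + q) (gm α q g) := by
  let e : {pq : ℕ × ℕ // (pq.1 : ℤ) - pq.2 = k} → ℤ := fun pq => pq.1.2
  have he : Function.Injective e := by
    rintro ⟨⟨p, q⟩, h⟩ ⟨⟨p', q'⟩, h'⟩ hqq
    simp only [e] at hqq h h'
    simp only [Subtype.mk.injEq, Prod.mk.injEq]
    omega
  refine Eq.trans (finsum_congr fun pq => ?_)
    (finsum_comp_of_support_subset (f := fun q : ℤ => gp α (k + q) (gm α q g)) he ?_)
  · obtain ⟨⟨p, q⟩, h⟩ := pq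
    simp only at h
    change _ = gp α (k + (q : ℤ)) (gm α (q : ℤ) g)
    rw [show k + (q : ℤ) = (p : ℤ) by omega]
    rfl
  · intro q hq
    have h2 : 0 ≤ q := by
      by_contra h
      exact hq (by simp only [gm]; rw [zcoeff_of_neg (by omega)]; simp)
    have h3 : 0 ≤ k + q := by
      by_contra h
      exact hq (by simp only [gp]; rw [zcoeff_of_neg (by omega)]; simp)
    exact ⟨⟨⟨(k + q).toNat, q.toNat⟩, by simp only; omega⟩, by simp only [e]; omega⟩

theorem vertexS_eq_zero {ℓ : ℕ} (α : Q ℓ) (g : SymAlg ℓ) :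
    ∃ N : ℤ, ∀ k < N, vertexS α k g = 0 := by
  obtain ⟨W, hW⟩ := exists_mem_filt g
  refine ⟨-W, fun k hk => ?_⟩
  rw [vertexS_apply, finsum_eq_zero_of_forall_eq_zero]
  intro q
  rcases lt_or_ge (k + q) 0 with h | h
  · rw [gp, zcoeff_of_neg h, LinearMap.zero_apply]
  · rcases lt_or_ge q 0 with hq | hq
    · rw [gm, zcoeff_of_neg hq, LinearMap.zero_apply, map_zero]
    · lift q to ℕ using hq
      have : gm α q g = 0 := filt_neg (by omega) (gammaMinus_mem_filt α q W g hW)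
      rw [this, map_zero]

/-- Operators whose commutators with `gammaPlus` and `gammaMinus` are `c z^n` and `c' z^{-n}`. -/
theorem apply_vertexS {ℓ : ℕ} {M : Module.End ℂ (SymAlg ℓ)} {α : Q ℓ} {c c' : ℂ} {n : ℤ}
    (hp : ∀ k, M * gp α k = gp α k * M + c • gp α (k - n))
    (hm : ∀ k, M * gm α k = gm α k * M + c' • gm α (k - n)) (k : ℤ) (g : SymAlg ℓ) :
    M (vertexS α k g) = vertexS α k (M g) + c • vertexS α (k - n) g +
      c' • vertexS α (k + n) g := by
  have e : vertexS α (k + n) g = ∑ᶠ q : ℤ, gp α (k + q) (gm α (q - n) g) := by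
    rw [vertexS_apply, ← finsum_comp_equiv (Equiv.subRight n)]
    refine finsum_congr fun q => ?_
    simp only [Equiv.subRight_apply]
    congr 2
    ring
  have hf : (Function.support fun q : ℤ => gp α (k + q) (gm α (q - n) g)).Finite := by
    refine ((gm_finite α g).preimage (f := fun q : ℤ => q - n)
      (sub_left_injective.injOn)).subset fun q hq h => hq (by simp only [h, map_zero])
  rw [e, vertexS_apply, vertexS_apply, vertexS_apply, map_finsum M (gp_gm_finite α _ g),
    smul_finsum' c (gp_gm_finite α _ g), smul_finsum' c' hf]
  have f1 : (Function.support fun q : ℤ => c • gp α (k - n + q) (gm α q g)).Finite :=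
    (gp_gm_finite α (fun q => k - n + q) g).subset
      (Function.support_const_smul_subset c (fun q : ℤ => gp α (k - n + q) (gm α q g)))
  have f2 : (Function.support fun q : ℤ => c' • gp α (k + q) (gm α (q - n) g)).Finite :=
    hf.subset (Function.support_const_smul_subset c' (fun q : ℤ => gp α (k + q) (gm α (q - n) g)))
  have f3 := gp_gm_finite α (fun q => k + q) (M g)
  rw [← finsum_add_distrib f3 f1,
    ← finsum_add_distrib ((f3.union f1).subset (Function.support_add _ _)) f2]
  refine finsum_congr fun q => ?_
  have h1 := LinearMap.congr_fun (hp (k + q)) (gm α q g)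
  have h2 := LinearMap.congr_fun (hm q) g
  simp only [Module.End.mul_apply, LinearMap.add_apply, LinearMap.smul_apply] at h1 h2
  rw [h1, h2, map_add, map_smul, show k - n + q = k + q - n by ring]
  abel

theorem heisPos_vertexS {ℓ : ℕ} (h : Fin ℓ → ℂ) (n : ℕ+) (α : Q ℓ) (k : ℤ) (g : SymAlg ℓ) :
    heisPos h n (vertexS α k g) =
      vertexS α k (heisPos h n g) + dot h α • vertexS α (k - (n : ℕ)) g := by
  rw [apply_vertexS (heisPos_mul_gp h n α) (heisPos_mul_gm h n α), zero_smul, add_zero]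

theorem heisNeg_vertexS {ℓ : ℕ} (h : Fin ℓ → ℂ) (n : ℕ+) (α : Q ℓ) (k : ℤ) (g : SymAlg ℓ) :
    heisNeg h n (vertexS α k g) =
      vertexS α k (heisNeg h n g) + dot h α • vertexS α (k + (n : ℕ)) g := by
  rw [apply_vertexS (heisNeg_mul_gp h n α) (heisNeg_mul_gm h n α), zero_smul, add_zero]

theorem X_mul_vertexS {ℓ : ℕ} (i : Fin ℓ) (n : ℕ+) (α : Q ℓ) (k : ℤ) (g : SymAlg ℓ) :
    MvPolynomial.X (i, n) * vertexS α k g =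
      vertexS α k (MvPolynomial.X (i, n) * g) + (α i : ℂ) • vertexS α (k + (n : ℕ)) g := by
  have h1 : ∀ g : SymAlg ℓ, heisNeg (Pi.single i 1) n g = MvPolynomial.X (i, n) * g := by
    intro g
    rw [heisNeg_apply, Finset.sum_eq_single i] <;> simp +contextual
  have h2 : dot (Pi.single i 1) α = (α i : ℂ) := by simp [dot, Pi.single_apply]
  have := heisNeg_vertexS (Pi.single i 1) n α k g
  rwa [h1, h1, h2] at this

/-! ### Schur polynomials and products of vertex operators -/

/-- The coefficient of `z^k` in `exp (∑_{n>0} (α s^{-n}) z^n / n)`. -/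
def schur {ℓ : ℕ} (α : Q ℓ) (k : ℤ) : SymAlg ℓ := gp α k 1

theorem gp_apply {ℓ : ℕ} (α : Q ℓ) (k : ℤ) (g : SymAlg ℓ) : gp α k g = schur α k * g := by
  induction g using MvPolynomial.induction_on with
  | C c => rw [mul_comm, ← MvPolynomial.smul_eq_C_mul, ← mul_one (MvPolynomial.C c),
      ← MvPolynomial.smul_eq_C_mul, map_smul, schur]
  | add f g hf hg => rw [map_add, hf, hg, mul_add]
  | mul_X g p hg =>
    have h1 : ∀ g : SymAlg ℓ, heisNeg (Pi.single p.1 1) p.2 g = g * MvPolynomial.X p := by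
      intro g
      rw [heisNeg_apply, Finset.sum_eq_single p.1] <;>
        simp +contextual [mul_comm]
    have := LinearMap.congr_fun (heisNeg_mul_gp (Pi.single p.1 1) p.2 α k) g
    rw [zero_smul, add_zero, Module.End.mul_apply, Module.End.mul_apply, h1, h1, hg] at this
    rw [← this, mul_assoc]

theorem schur_of_neg {ℓ : ℕ} (α : Q ℓ) {k : ℤ} (hk : k < 0) : schur α k = 0 := by
  rw [schur, gp, zcoeff_of_neg hk, LinearMap.zero_apply]

theorem gm_zero {ℓ : ℕ} (α : Q ℓ) : gm α 0 = 1 := by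
  rw [← constantCoeff_expSeries (logMinus α), ← PowerSeries.coeff_zero_eq_constantCoeff_apply]
  rfl

theorem gm_one_of_ne {ℓ : ℕ} (α : Q ℓ) {k : ℤ} (hk : k ≠ 0) : gm α k 1 = 0 := by
  rcases lt_or_gt_of_ne hk with h | h
  · rw [gm, zcoeff_of_neg h, LinearMap.zero_apply]
  · lift k to ℕ using h.le
    refine filt_neg (W := 0 - (k : ℤ)) (by omega) (gammaMinus_mem_filt α k 0 1 fun d hd => ?_)
    have : d = 0 := by
      classical
      by_contra h0
      rw [MvPolynomial.coeff_one, if_neg (Ne.symm h0)] at hd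
      exact hd rfl
    simp [this]

theorem vertexS_one {ℓ : ℕ} (α : Q ℓ) (k : ℤ) : vertexS α k 1 = schur α k := by
  rw [vertexS_apply, finsum_eq_single _ 0, gm_zero, add_zero]
  · rfl
  · intro q hq
    rw [gm_one_of_ne α hq, map_zero]

theorem heisPos_schur {ℓ : ℕ} (h : Fin ℓ → ℂ) (n : ℕ+) (α : Q ℓ) (k : ℤ) :
    heisPos h n (schur α k) = dot h α • schur α (k - (n : ℕ)) := by
  have := LinearMap.congr_fun (heisPos_mul_gp h n α k) 1
  rw [Module.End.mul_apply, LinearMap.add_apply, Module.End.mul_apply, heisPos_one, map_zero,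
    zero_add, LinearMap.smul_apply] at this
  exact this

/-- The action of `gammaMinus` on Schur polynomials: if `∑_q c_q t^q = (1 - t)^{(α | β)}`, which is
expressed by the recursion for `c`, then `gm α q` maps `schur β p` to `c_q schur β (p - q)`. -/
theorem gm_schur {ℓ : ℕ} (α β : Q ℓ) (c : ℕ → ℂ) (h0 : c 0 = 1)
    (hc : ∀ q : ℕ, (q : ℂ) * c q = -(form α β : ℂ) * ∑ b ∈ Finset.range q, c b) (q : ℕ) (p : ℤ) :
    gm α q (schur β p) = c q • schur β (p - q) := by
  induction q using Nat.strong_induction_on with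
  | _ q ih =>
    rcases Nat.eq_zero_or_pos q with rfl | hq
    · rw [Nat.cast_zero, gm_zero, h0, one_smul, sub_zero]
      rfl
    · have hq0 : (q : ℂ) ≠ 0 := by exact_mod_cast hq.ne'
      refine smul_right_injective _ hq0 ?_
      have e : (q : ℂ) • gm α q = ∑ b ∈ Finset.range q,
          -(heisPos (toH α) (q - b - 1).succPNat * gm α b) := by
        have := congrArg (PowerSeries.coeff q)
          (euler_expSeries (constantCoeff_logMinus α) (commute_logMinus α))
        rw [coeff_euler, PowerSeries.coeff_mul, ← Finset.Nat.sum_antidiagonal_swap,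
          Finset.Nat.sum_antidiagonal_eq_sum_range_succ_mk, Finset.sum_range_succ] at this
        refine this.trans ?_
        simp only [Prod.swap_prod_mk, tsub_self, coeff_euler, Nat.cast_zero, zero_smul, zero_mul,
          add_zero]
        refine Finset.sum_congr rfl fun b hb => ?_
        have hb' := Finset.mem_range.1 hb
        have hqb' : ((q - b : ℕ) : ℂ) ≠ 0 := by exact_mod_cast (by omega : q - b ≠ 0)
        have hqb : q - b = (q - b - 1).succPNat := by
          rw [Nat.succPNat_coe]
          omega
        generalize (q - b - 1).succPNat = n at hqb
        rw [hqb] at hqb' ⊢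
        rw [coeff_logMinus, smul_smul, mul_neg, mul_inv_cancel₀ hqb', neg_one_smul]
        exact LinearMap.ext fun _ => rfl
      have e2 := LinearMap.congr_fun e (schur β p)
      rw [LinearMap.smul_apply, LinearMap.sum_apply] at e2
      refine e2.trans ?_
      simp only
      rw [smul_smul, hc, Finset.mul_sum, Finset.sum_smul]
      refine Finset.sum_congr rfl fun b hb => ?_
      have hb' := Finset.mem_range.1 hb
      rw [LinearMap.neg_apply, Module.End.mul_apply, ih b hb', map_smul, heisPos_schur, dot_toH,
        smul_smul, ← neg_smul, Nat.succPNat_coe]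
      congr 1
      · ring
      · congr 1
        omega

theorem vertexS_schur {ℓ : ℕ} (α β : Q ℓ) (c : ℕ → ℂ) (h0 : c 0 = 1)
    (hc : ∀ q : ℕ, (q : ℂ) * c q = -(form α β : ℂ) * ∑ b ∈ Finset.range q, c b) (a b : ℤ) :
    vertexS α a (schur β b) = ∑ᶠ q : ℕ, c q • (schur α (a + q) * schur β (b - q)) := by
  rw [vertexS_apply]
  have h1 : ∀ q : ℕ, c q • (schur α (a + q) * schur β (b - q)) =
      (fun q : ℤ => gp α (a + q) (gm α q (schur β b))) (q : ℤ) := by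
    intro q
    simp only
    rw [gm_schur α β c h0 hc, map_smul, gp_apply]
  rw [finsum_congr h1]
  refine (finsum_comp_of_support_subset (f := fun q : ℤ => gp α (a + q) (gm α q (schur β b)))
    Nat.cast_injective fun q hq => ?_).symm
  have h2 : 0 ≤ q := by
    by_contra h
    exact hq (by simp only [gm]; rw [zcoeff_of_neg (by omega)]; simp)
  exact ⟨q.toNat, by omega⟩

theorem zcoeff_mul {A : Type*} [Ring A] (f g : PowerSeries A) (k : ℤ) :
    zcoeff k (f * g) = ∑ᶠ i : ℤ, zcoeff i f * zcoeff (k - i) g := by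
  rcases lt_or_ge k 0 with hk | hk
  · rw [zcoeff_of_neg hk, finsum_eq_zero_of_forall_eq_zero]
    intro i
    rcases lt_or_ge i 0 with hi | hi
    · rw [zcoeff_of_neg hi, zero_mul]
    · rw [zcoeff_of_neg (k := k - i) (by omega), mul_zero]
  · lift k to ℕ using hk
    rw [zcoeff_natCast, PowerSeries.coeff_mul, Finset.Nat.sum_antidiagonal_eq_sum_range_succ_mk,
      finsum_eq_sum_of_support_subset (s := (Finset.range (k + 1)).map Nat.castEmbedding)]
    · rw [Finset.sum_map]
      refine Finset.sum_congr rfl fun i hi => ?_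
      have := Finset.mem_range.1 hi
      simp only [Nat.castEmbedding_apply]
      rw [← Nat.cast_sub (by omega)]
      rfl
    · intro i hi
      have h2 : 0 ≤ i := by
        by_contra h
        exact hi (by simp only; rw [zcoeff_of_neg (by omega)]; simp)
      have h3 : 0 ≤ k - i := by
        by_contra h
        exact hi (by simp only; rw [zcoeff_of_neg (k := k - i) (by omega)]; simp)
      simp only [Finset.coe_map, Set.mem_image, Finset.mem_coe, Finset.mem_range]
      exact ⟨i.toNat, by omega, by simp [h2]⟩

/-- The exponent of the generating series of the Schur polynomials. -/
def logSchur {ℓ : ℕ} (α : Q ℓ) : PowerSeries (SymAlg ℓ) :=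
  PowerSeries.mk fun n => if hn : 0 < n then
    (n : ℂ)⁻¹ • ∑ i, (α i : ℂ) • (MvPolynomial.X (i, ⟨n, hn⟩) : SymAlg ℓ) else 0

theorem coeff_logSchur {ℓ : ℕ} (α : Q ℓ) (n : ℕ+) : PowerSeries.coeff (n : ℕ) (logSchur α) =
    ((n : ℕ) : ℂ)⁻¹ • ∑ i, (α i : ℂ) • (MvPolynomial.X (i, n) : SymAlg ℓ) := by
  rw [logSchur, PowerSeries.coeff_mk, dif_pos n.pos]
  rfl

theorem constantCoeff_logSchur {ℓ : ℕ} (α : Q ℓ) : PowerSeries.constantCoeff (logSchur α) = 0 := by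
  rw [← PowerSeries.coeff_zero_eq_constantCoeff_apply, logSchur, PowerSeries.coeff_mk,
    dif_neg (lt_irrefl 0)]

theorem schur_eq {ℓ : ℕ} (α : Q ℓ) (k : ℤ) : schur α k = zcoeff k (expSeries (logSchur α)) := by
  have h : logPlus α =
      PowerSeries.map (Algebra.lmul ℂ (SymAlg ℓ) : SymAlg ℓ →+* _) (logSchur α) := by
    ext1 n
    rw [PowerSeries.coeff_map]
    rcases Nat.eq_zero_or_pos n with rfl | hn
    · rw [PowerSeries.coeff_zero_eq_constantCoeff_apply, constantCoeff_logPlus,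
        PowerSeries.coeff_zero_eq_constantCoeff_apply, constantCoeff_logSchur, map_zero]
    · lift n to ℕ+ using hn
      rw [coeff_logPlus, coeff_logSchur]
      refine LinearMap.ext fun g => ?_
      rw [LinearMap.smul_apply, heisNeg_apply]
      simp [toH, Finset.sum_mul]
  rw [schur, gp]
  change zcoeff k (expSeries (logPlus α)) 1 = _
  rw [h, ← map_expSeries]
  rcases lt_or_ge k 0 with hk | hk
  · rw [zcoeff_of_neg hk, zcoeff_of_neg hk, LinearMap.zero_apply]
  · lift k to ℕ using hk
    rw [zcoeff_natCast, zcoeff_natCast, PowerSeries.coeff_map]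
    simp

theorem schur_add {ℓ : ℕ} (α β : Q ℓ) (k : ℤ) :
    schur (α + β) k = ∑ᶠ i : ℤ, schur α i * schur β (k - i) := by
  have h : logSchur (α + β) = logSchur α + logSchur β := by
    ext1 n
    simp only [logSchur, map_add, PowerSeries.coeff_mk]
    split_ifs
    · simp [add_smul, Finset.sum_add_distrib]
    · simp
  simp only [schur_eq]
  rw [h, expSeries_add (constantCoeff_logSchur α) (constantCoeff_logSchur β), zcoeff_mul]

/-- An exchange relation between vertex operators holds as soon as it holds on the vector `1`: both
sides have the same commutators with the multiplications by the generators of the symmetric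
algebra. -/
theorem vertexS_exchange {ℓ : ℕ} {α β : Q ℓ} {x : ℤ} {s t : ℂ}
    (h : ∀ a b, vertexS α a (schur β b) + s • vertexS β (b - x) (schur α (a + x)) =
      t • schur (α + β) (a + b)) (g : SymAlg ℓ) (a b : ℤ) :
    vertexS α a (vertexS β b g) + s • vertexS β (b - x) (vertexS α (a + x) g) =
      t • vertexS (α + β) (a + b) g := by
  induction g using MvPolynomial.induction_on generalizing a b with
  | C c =>
    rw [← mul_one (MvPolynomial.C c), ← MvPolynomial.smul_eq_C_mul]
    simp only [map_smul, vertexS_one]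
    rw [smul_comm s, smul_comm t, ← smul_add, h]
  | add f g hf hg =>
    simp only [map_add, smul_add]
    rw [← hf, ← hg]
    abel
  | mul_X g p hg =>
    obtain ⟨i, n⟩ := p
    have key : ∀ (γ : Q ℓ) (k : ℤ) (g : SymAlg ℓ), vertexS γ k (MvPolynomial.X (i, n) * g) =
        MvPolynomial.X (i, n) * vertexS γ k g - (γ i : ℂ) • vertexS γ (k + (n : ℕ)) g :=
      fun γ k g => by rw [X_mul_vertexS, add_sub_cancel_right]
    rw [mul_comm g]
    simp only [key, map_sub, map_smul]
    have h0 := congrArg (MvPolynomial.X (i, n) * ·) (hg a b)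
    have h1 := hg (a + (n : ℕ)) b
    have h2 := hg a (b + (n : ℕ))
    rw [show a + ((n : ℕ) : ℤ) + x = a + x + (n : ℕ) by ring,
      show a + ((n : ℕ) : ℤ) + b = a + b + (n : ℕ) by ring] at h1
    rw [show b + ((n : ℕ) : ℤ) - x = b - x + (n : ℕ) by ring, ← add_assoc] at h2
    simp only [mul_add, mul_smul_comm] at h0
    rw [Pi.add_apply, Int.cast_add]
    linear_combination (norm := module) h0 - (α i : ℂ) • h1 - (β i : ℂ) • h2

theorem vertexS_comm_of_form_eq_zero {ℓ : ℕ} {α β : Q ℓ} (h : form α β = 0) (g : SymAlg ℓ)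
    (a b : ℤ) : vertexS α a (vertexS β b g) = vertexS β b (vertexS α a g) := by
  have hc : ∀ γ δ : Q ℓ, form γ δ = 0 → ∀ a b, vertexS γ a (schur δ b) = schur γ a * schur δ b := by
    intro γ δ h a b
    rw [vertexS_schur γ δ (fun q => if q = 0 then 1 else 0) (if_pos rfl), finsum_eq_single _ 0]
    · simp
    · intro q hq
      simp [hq]
    · intro q
      rcases Nat.eq_zero_or_pos q with rfl | hq
      · simp
      · simp [h, hq.ne']
  have h' : form β α = 0 := by rw [← h]; simp [form, mul_comm]
  have := vertexS_exchange (α := α) (β := β) (x := 0) (s := -1) (t := 0) (fun a b => by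
    rw [hc α β h, hc β α h']
    simp [mul_comm]) g a b
  simpa [add_neg_eq_zero] using this

theorem vertexS_comm_of_form_eq_one {ℓ : ℕ} {α β : Q ℓ} (h : form α β = 1) (g : SymAlg ℓ)
    (a b : ℤ) : vertexS α a (vertexS β b g) = -vertexS β (b - 1) (vertexS α (a + 1) g) := by
  have hc : ∀ γ δ : Q ℓ, form γ δ = 1 → ∀ a b, vertexS γ a (schur δ b) =
      schur γ a * schur δ b - schur γ (a + 1) * schur δ (b - 1) := by
    intro γ δ h a b
    rw [vertexS_schur γ δ (fun q => if q = 0 then 1 else if q = 1 then -1 else 0) (if_pos rfl),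
      finsum_eq_sum_of_support_subset (s := Finset.range 2)]
    · simp [Finset.sum_range_succ, sub_eq_add_neg]
    · intro q hq
      simp only [Finset.coe_range, Set.mem_Iio]
      by_contra h2
      exact hq (by simp only; rw [if_neg (by omega), if_neg (by omega), zero_smul])
    · intro q
      rcases q with _ | _ | q
      · simp
      · simp [h]
      · rw [Finset.sum_range_succ', Finset.sum_range_succ']
        simp
  have h' : form β α = 1 := by rw [← h]; simp [form, mul_comm]
  have := vertexS_exchange (α := α) (β := β) (x := 1) (s := 1) (t := 0) (fun a b => by
    rw [hc α β h, hc β α h', sub_add_cancel, add_sub_cancel_right]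
    rw [one_smul, zero_smul]
    ring) g a b
  rw [one_smul, zero_smul] at this
  exact eq_neg_of_add_eq_zero_left this

/-- A finitely supported sum over `ℤ`, split into the indices `≥ a` and those `< a`. -/
theorem finsum_int_split {M : Type*} [AddCommMonoid M] {f : ℤ → M}
    (hf : (Function.support f).Finite) (a : ℤ) :
      ∑ᶠ q : ℕ, f (a + q) + ∑ᶠ q : ℕ, f (a - 1 - q) = ∑ᶠ i, f i := by
  classical
  have e1 : ∑ᶠ q : ℕ, f (a + q) = ∑ᶠ i, if a ≤ i then f i else 0 := by
    rw [← finsum_comp_of_support_subset (e := fun q : ℕ => a + q)]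
    · exact finsum_congr fun q => by rw [if_pos (by omega)]
    · intro p q h
      simpa using h
    · intro i hi
      by_cases h : a ≤ i
      · exact ⟨(i - a).toNat, by simp only; omega⟩
      · exact absurd (if_neg h) hi
  have e2 : ∑ᶠ q : ℕ, f (a - 1 - q) = ∑ᶠ i, if a ≤ i then 0 else f i := by
    rw [← finsum_comp_of_support_subset (e := fun q : ℕ => a - 1 - q)]
    · exact finsum_congr fun q => by rw [if_neg (by omega)]
    · intro p q h
      simpa using h
    · intro i hi
      by_cases h : a ≤ i
      · exact absurd (if_pos h) hi
      · exact ⟨(a - 1 - i).toNat, by simp only; omega⟩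
  rw [e1, e2, ← finsum_add_distrib]
  · refine finsum_congr fun i => ?_
    split_ifs <;> simp
  · refine hf.subset fun i hi h => hi ?_
    simp only [h, ite_self]
  · refine hf.subset fun i hi h => hi ?_
    simp only [h, ite_self]

theorem schur_mul_finite {ℓ : ℕ} (α β : Q ℓ) (k : ℤ) :
    (Function.support fun i : ℤ => schur α i * schur β (k - i)).Finite := by
  refine (Set.finite_Icc 0 k).subset fun i hi => ?_
  constructor
  · by_contra h
    exact hi (by simp only; rw [schur_of_neg α (by omega), zero_mul])
  · by_contra h
    exact hi (by simp only; rw [schur_of_neg β (by omega), mul_zero])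

/-- For `(α | β) = -1` the two expansions of `(z - w)⁻¹` add up to the formal delta function, which
leaves the vertex operator of `α + β`. -/
theorem vertexS_comm_of_form_eq_neg_one {ℓ : ℕ} {α β : Q ℓ} (h : form α β = -1) (g : SymAlg ℓ)
    (a b : ℤ) : vertexS α a (vertexS β b g) + vertexS β (b + 1) (vertexS α (a - 1) g) =
      vertexS (α + β) (a + b) g := by
  have hc : ∀ γ δ : Q ℓ, form γ δ = -1 → ∀ a b, vertexS γ a (schur δ b) =
      ∑ᶠ q : ℕ, schur γ (a + q) * schur δ (b - q) := by
    intro γ δ h a b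
    rw [vertexS_schur γ δ (fun _ => 1) rfl]
    · simp
    · intro q
      simp [h]
  have h' : form β α = -1 := by rw [← h]; simp [form, mul_comm]
  have := vertexS_exchange (α := α) (β := β) (x := -1) (s := 1) (t := 1) (fun a b => by
    rw [hc α β h, hc β α h', schur_add, one_smul, one_smul,
      ← finsum_int_split (schur_mul_finite α β (a + b)) a]
    congr 1
    · refine finsum_congr fun q => ?_
      congr 2
      ring
    · refine finsum_congr fun q => ?_
      rw [mul_comm]
      congr 2
      ring) g a b
  rw [one_smul, one_smul, sub_neg_eq_add, ← sub_eq_add_neg] at this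
  exact this

/-! ### The cocycle -/

theorem form_add_left {ℓ : ℕ} (α β γ : Q ℓ) : form (α + β) γ = form α γ + form β γ := by
  simp [form, add_mul, Finset.sum_add_distrib]

theorem form_add_right {ℓ : ℕ} (α β γ : Q ℓ) : form α (β + γ) = form α β + form α γ := by
  simp [form, mul_add, Finset.sum_add_distrib]

theorem form_neg_left {ℓ : ℕ} (α β : Q ℓ) : form (-α) β = -form α β := by
  simp [form]

theorem form_neg_right {ℓ : ℕ} (α β : Q ℓ) : form α (-β) = -form α β := by
  simp [form]

theorem form_sub_left {ℓ : ℕ} (α β γ : Q ℓ) : form (α - β) γ = form α γ - form β γ := by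
  rw [sub_eq_add_neg, form_add_left, form_neg_left, ← sub_eq_add_neg]

theorem form_sub_right {ℓ : ℕ} (α β γ : Q ℓ) : form α (β - γ) = form α β - form α γ := by
  rw [sub_eq_add_neg, form_add_right, form_neg_right, ← sub_eq_add_neg]

theorem form_comm {ℓ : ℕ} (α β : Q ℓ) : form α β = form β α := by
  simp [form, mul_comm]

theorem form_v_left {ℓ : ℕ} (i : Fin ℓ) (α : Q ℓ) : form (v i) α = α i := by
  simp [form, v, Pi.single_apply]

theorem form_v_v {ℓ : ℕ} (i j : Fin ℓ) : form (v i) (v j) = if i = j then 1 else 0 := by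
  rw [form_v_left, v, Pi.single_apply]

theorem eps_add_left {ℓ : ℕ} (α β γ : Q ℓ) : eps (α + β) γ = eps α γ * eps β γ := by
  simp only [eps, ← Finset.prod_mul_distrib, ← zpow_add, Pi.add_apply, add_mul]

theorem eps_add_right {ℓ : ℕ} (α β γ : Q ℓ) : eps α (β + γ) = eps α β * eps α γ := by
  simp only [eps, ← Finset.prod_mul_distrib, ← zpow_add, Pi.add_apply, mul_add]

theorem eps_neg_left {ℓ : ℕ} (α β : Q ℓ) : eps (-α) β = eps α β := by
  refine (?_ : _ = (eps α β)⁻¹).trans (Int.units_inv_eq_self _)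
  simp only [eps, ← Finset.prod_inv_distrib, ← zpow_neg, Pi.neg_apply, neg_mul]

theorem eps_neg_right {ℓ : ℕ} (α β : Q ℓ) : eps α (-β) = eps α β := by
  refine (?_ : _ = (eps α β)⁻¹).trans (Int.units_inv_eq_self _)
  simp only [eps, ← Finset.prod_inv_distrib, ← zpow_neg, Pi.neg_apply, mul_neg]

theorem prod_zpow_eq_zpow_sum {ι G : Type*} [CommGroup G] (s : Finset ι) (u : G) (f : ι → ℤ) :
    ∏ i ∈ s, u ^ f i = u ^ ∑ i ∈ s, f i := by
  classical
  induction s using Finset.induction_on with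
  | empty => simp
  | insert i s hi ih => rw [Finset.prod_insert hi, Finset.sum_insert hi, ih, zpow_add]

/-- The symmetry of the cocycle, `ε(α, β) ε(β, α) = (-1)^{|α| |β| + (α | β)}`, `|α| = ∑ α_i`. -/
theorem eps_mul_eps_swap {ℓ : ℕ} (α β : Q ℓ) :
    eps α β * eps β α = (-1) ^ ((∑ i, α i) * (∑ i, β i) + form α β) := by
  have h : ∀ i j : Fin ℓ, epsBasis i j * epsBasis j i =
      (-1) ^ (1 + if i = j then (1 : ℤ) else 0) := by
    intro i j
    rcases lt_trichotomy i j with h | h | h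
    · simp [epsBasis, h, h.ne, not_lt.2 h.le]
    · subst h
      simp [epsBasis]
    · simp [epsBasis, h, h.ne', not_lt.2 h.le]
  have h1 : eps β α = ∏ i, ∏ j, epsBasis j i ^ (α i * β j) := by
    rw [eps, Finset.prod_comm]
    simp only [mul_comm]
  rw [h1, eps]
  simp only [← Finset.prod_mul_distrib, ← mul_zpow, h, ← zpow_mul]
  simp only [prod_zpow_eq_zpow_sum]
  congr 1
  simp only [add_mul, Finset.sum_add_distrib, one_mul, ite_mul, zero_mul, Finset.sum_ite_eq,
    Finset.mem_univ, if_true, form, Finset.sum_mul_sum]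

theorem epsC_add_left {ℓ : ℕ} (α β γ : Q ℓ) : epsC (α + β) γ = epsC α γ * epsC β γ := by
  simp [epsC, eps_add_left]

theorem epsC_add_right {ℓ : ℕ} (α β γ : Q ℓ) : epsC α (β + γ) = epsC α β * epsC α γ := by
  simp [epsC, eps_add_right]

theorem epsC_neg_left {ℓ : ℕ} (α β : Q ℓ) : epsC (-α) β = epsC α β := by
  rw [epsC, eps_neg_left, epsC]

theorem epsC_neg_right {ℓ : ℕ} (α β : Q ℓ) : epsC α (-β) = epsC α β := by
  rw [epsC, eps_neg_right, epsC]

theorem epsC_sub_left {ℓ : ℕ} (α β γ : Q ℓ) : epsC (α - β) γ = epsC α γ * epsC β γ := by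
  rw [sub_eq_add_neg, epsC_add_left, epsC_neg_left]

theorem epsC_sub_right {ℓ : ℕ} (α β γ : Q ℓ) : epsC α (β - γ) = epsC α β * epsC α γ := by
  rw [sub_eq_add_neg, epsC_add_right, epsC_neg_right]

theorem epsC_mul_self {ℓ : ℕ} (α β : Q ℓ) : epsC α β * epsC α β = 1 := by
  rcases Int.units_eq_one_or (eps α β) with h | h <;> simp [epsC, h]

theorem epsC_swap {ℓ : ℕ} {α : Q ℓ} (hα : ∑ i, α i = 0) (β : Q ℓ) :
    epsC β α = (-1) ^ form α β * epsC α β := by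
  have h := eps_mul_eps_swap α β
  rw [hα, zero_mul, zero_add] at h
  have h2 : epsC α β * epsC β α = (-1) ^ form α β := by
    simp only [epsC]
    rw [← Int.cast_mul, ← Units.val_mul, h]
    rcases Int.even_or_odd (form α β) with h3 | h3
    · simp [h3.neg_one_zpow]
    · simp [h3.neg_one_zpow]
  rw [← h2, mul_comm (epsC α β), mul_assoc, epsC_mul_self, mul_one]

theorem eps_v_v {ℓ : ℕ} (i j : Fin ℓ) : eps (v i) (v j) = epsBasis i j := by
  rw [eps, Finset.prod_eq_single i, Finset.prod_eq_single j]
  · simp [v]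
  · intro b _ hb
    simp [v, hb]
  · simp
  · intro b _ hb
    simp [v, hb]
  · simp

/-! ### Vertex operators on the state space -/

theorem expMode_single {ℓ : ℕ} (α : Q ℓ) (m : ℤ) (β : Q ℓ) (g : SymAlg ℓ) :
    expMode α m (Finsupp.single β g) =
      Finsupp.single (α + β) (epsC α β • vertexS α (-m - 1 - form α β) g) := by
  simp [expMode]

theorem expMode_apply {ℓ : ℕ} (α : Q ℓ) (m : ℤ) (f : VQ ℓ) (γ : Q ℓ) :
    expMode α m f γ = epsC α (γ - α) • vertexS α (-m - 1 - form α (γ - α)) (f (γ - α)) := by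
  classical
  induction f using Finsupp.induction_linear with
  | zero => simp
  | add f g hf hg => rw [map_add, Finsupp.add_apply, hf, hg, Finsupp.add_apply, map_add, smul_add]
  | single β g =>
    rw [expMode_single]
    by_cases h : β = γ - α
    · subst h
      simp
    · rw [Finsupp.single_apply, if_neg (by rintro rfl; simp at h), Finsupp.single_apply, if_neg h,
        map_zero, smul_zero]

theorem heis_zero_single {ℓ : ℕ} (h : Fin ℓ → ℂ) (β : Q ℓ) (g : SymAlg ℓ) :
    heis h (Int.ofNat 0) (Finsupp.single β g) = Finsupp.single β (dot h β • g) := by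
  simp [heis, dot]

theorem heis_pos_single {ℓ : ℕ} (h : Fin ℓ → ℂ) (n : ℕ) (β : Q ℓ) (g : SymAlg ℓ) :
    heis h (Int.ofNat (n + 1)) (Finsupp.single β g) =
      Finsupp.single β (heisPos h n.succPNat g) := by
  simp [heis]

theorem heis_neg_single {ℓ : ℕ} (h : Fin ℓ → ℂ) (n : ℕ) (β : Q ℓ) (g : SymAlg ℓ) :
    heis h (Int.negSucc n) (Finsupp.single β g) = Finsupp.single β (heisNeg h n.succPNat g) := by
  simp [heis]

theorem dot_add {ℓ : ℕ} (h : Fin ℓ → ℂ) (α β : Q ℓ) : dot h (α + β) = dot h α + dot h β := by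
  simp [dot, mul_add, Finset.sum_add_distrib]

theorem dot_neg {ℓ : ℕ} (h : Fin ℓ → ℂ) (α : Q ℓ) : dot h (-α) = -dot h α := by
  simp [dot]

/-- `[h_{(n)}, (e^α)_{(m)}] = (h | α) (e^α)_{(m+n)}`. -/
theorem heis_expMode {ℓ : ℕ} (h : Fin ℓ → ℂ) (n : ℤ) (α : Q ℓ) (m : ℤ) (f : VQ ℓ) :
    heis h n (expMode α m f) = expMode α m (heis h n f) + dot h α • expMode α (m + n) f := by
  induction f using Finsupp.induction_linear with
  | zero => simp
  | add f g hf hg =>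
    simp only [map_add, smul_add, hf, hg]
    abel
  | single β g =>
    rcases n with (_ | n) | n
    · rw [heis_zero_single, expMode_single, expMode_single,
        heis_zero_single, expMode_single, Finsupp.smul_single, ← Finsupp.single_add,
        show m + Int.ofNat 0 = m from add_zero m,
        dot_add, map_smul]
      congr 1
      module
    · rw [heis_pos_single, expMode_single, expMode_single, heis_pos_single, expMode_single,
        Finsupp.smul_single, ← Finsupp.single_add, map_smul, heisPos_vertexS, smul_add,
        smul_comm (dot h α), show -(m + Int.ofNat (n + 1)) - 1 - form α β =
          -m - 1 - form α β - (n.succPNat : ℕ) by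
            rw [Nat.succPNat_coe, Int.ofNat_eq_natCast]
            push_cast
            ring]
    · rw [heis_neg_single, expMode_single, expMode_single, heis_neg_single, expMode_single,
        Finsupp.smul_single, ← Finsupp.single_add, map_smul, heisNeg_vertexS, smul_add,
        smul_comm (dot h α), show -(m + Int.negSucc n) - 1 - form α β =
          -m - 1 - form α β + (n.succPNat : ℕ) by
            rw [Nat.succPNat_coe, Int.negSucc_eq]
            push_cast
            ring]

theorem expMode_comm {ℓ : ℕ} {α β : Q ℓ} (hα : ∑ i, α i = 0) (h : form α β = 0 ∨ form α β = 1)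
    (m n : ℤ) (f : VQ ℓ) : expMode α m (expMode β n f) = expMode β n (expMode α m f) := by
  induction f using Finsupp.induction_linear with
  | zero => simp
  | add f g hf hg => simp only [map_add, hf, hg]
  | single γ g =>
    simp only [expMode_single]
    rw [add_left_comm]
    congr 1
    simp only [map_smul]
    rw [epsC_add_right, epsC_add_right, epsC_swap hα β, form_add_right, form_add_right,
      form_comm β α, smul_smul, smul_smul]
    rcases h with h | h
    · rw [h, zero_add, zero_add, vertexS_comm_of_form_eq_zero h, zpow_zero]
      congr 1
      ring
    · rw [h, vertexS_comm_of_form_eq_one h, zpow_one, smul_neg, ← neg_smul]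
      congr 1
      · ring
      · congr 2
        · ring
        · congr 1
          ring

theorem expMode_comm_of_form_eq_neg_one {ℓ : ℕ} {α β : Q ℓ} (hα : ∑ i, α i = 0)
    (h : form α β = -1) (m n : ℤ) (f : VQ ℓ) :
    expMode α m (expMode β n f) =
      expMode β n (expMode α m f) + epsC α β • expMode (α + β) (n + m) f := by
  induction f using Finsupp.induction_linear with
  | zero => simp
  | add f g hf hg =>
    simp only [map_add, smul_add, hf, hg]
    abel
  | single γ g =>
    simp only [expMode_single]
    rw [← sub_eq_iff_eq_add', add_left_comm β, ← Finsupp.single_sub, ← add_assoc,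
      Finsupp.smul_single]
    congr 1
    simp only [map_smul]
    rw [epsC_add_right, epsC_add_right, epsC_swap hα β, form_add_right, form_add_right,
      form_add_left, form_comm β α, smul_smul, smul_smul, smul_smul, h, epsC_add_left,
      show (-(n + m) - 1 - (form α γ + form β γ)) =
        (-m - 1 - (-1 + form α γ)) + (-n - 1 - form β γ) by ring,
      ← vertexS_comm_of_form_eq_neg_one h,
      show -n - 1 - form β γ + 1 = -n - 1 - (-1 + form β γ) by ring,
      show -m - 1 - (-1 + form α γ) - 1 = -m - 1 - form α γ by ring]
    rw [zpow_neg_one]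
    module

theorem expMode_eq_zero {ℓ : ℕ} (α : Q ℓ) (f : VQ ℓ) : ∃ N : ℤ, ∀ m, N < m → expMode α m f = 0 := by
  induction f using Finsupp.induction_linear with
  | zero => exact ⟨0, fun m _ => map_zero _⟩
  | add f g hf hg =>
    obtain ⟨N, hN⟩ := hf
    obtain ⟨M, hM⟩ := hg
    refine ⟨max N M, fun m hm => ?_⟩
    rw [map_add, hN m (lt_of_le_of_lt (le_max_left _ _) hm),
      hM m (lt_of_le_of_lt (le_max_right _ _) hm), add_zero]
  | single β g =>
    obtain ⟨N, hN⟩ := vertexS_eq_zero α g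
    refine ⟨-N - 1 - form α β, fun m hm => ?_⟩
    rw [expMode_single, hN _ (by omega), smul_zero, Finsupp.single_zero]

/-! ### The bilinear operator `∑_k Res_z z^m E^{v_k}(z) ⊗ E^{-v_k}(z)` -/

open TensorProduct

theorem modeTensor_finite {ℓ : ℕ} (α β : Q ℓ) (s : ℤ) (f g : VQ ℓ) :
    (Function.support fun r : ℤ => expMode α r f ⊗ₜ[ℂ] expMode β (s - r) g).Finite := by
  obtain ⟨N, hN⟩ := expMode_eq_zero α f
  obtain ⟨M, hM⟩ := expMode_eq_zero β g
  refine (Set.finite_Icc (s - M) N).subset fun r hr => ?_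
  constructor
  · by_contra h
    exact hr (by simp only; rw [hM (s - r) (by omega), tmul_zero])
  · by_contra h
    exact hr (by simp only; rw [hN r (by omega), zero_tmul])

/-- `Res_z z^{s+1} E^α(z) f ⊗ E^β(z) g = ∑_r (e^α)_{(r)} f ⊗ (e^β)_{(s-r)} g`. -/
def modeTensor {ℓ : ℕ} (α β : Q ℓ) (s : ℤ) : VQ ℓ →ₗ[ℂ] VQ ℓ →ₗ[ℂ] VQ ℓ ⊗[ℂ] VQ ℓ :=
  LinearMap.mk₂ ℂ (fun f g => ∑ᶠ r : ℤ, expMode α r f ⊗ₜ[ℂ] expMode β (s - r) g)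
    (fun f f' g => by
      rw [← finsum_add_distrib (modeTensor_finite α β s f g) (modeTensor_finite α β s f' g)]
      simp only [map_add, add_tmul])
    (fun c f g => by
      rw [smul_finsum' c (modeTensor_finite α β s f g)]
      simp only [map_smul, smul_tmul'])
    (fun f g g' => by
      rw [← finsum_add_distrib (modeTensor_finite α β s f g) (modeTensor_finite α β s f g')]
      simp only [map_add, tmul_add])
    (fun c f g => by
      rw [smul_finsum' c (modeTensor_finite α β s f g)]
      simp only [map_smul, tmul_smul])

theorem modeTensor_apply {ℓ : ℕ} (α β : Q ℓ) (s : ℤ) (f g : VQ ℓ) :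
    modeTensor α β s f g = ∑ᶠ r : ℤ, expMode α r f ⊗ₜ[ℂ] expMode β (s - r) g := rfl

/-- The operator `X ⊗ 1 + 1 ⊗ X`. -/
def coprod {V : Type*} [AddCommGroup V] [Module ℂ V] (X : Module.End ℂ V) :
    Module.End ℂ (V ⊗[ℂ] V) := X.rTensor V + X.lTensor V

theorem coprod_tmul {V : Type*} [AddCommGroup V] [Module ℂ V] (X : Module.End ℂ V) (f g : V) :
    coprod X (f ⊗ₜ g) = X f ⊗ₜ g + f ⊗ₜ X g := rfl

/-- If `X` shifts the modes of `E^α` and `E^β` into those of `E^{α'}` and `E^{β'}`, it acts on the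
coefficients of `E^α(z) ⊗ E^β(z)` by the Leibniz rule. -/
theorem coprod_modeTensor {ℓ : ℕ} {X : Module.End ℂ (VQ ℓ)} {α β α' β' : Q ℓ} {c c' : ℂ} {n : ℤ}
    (hα : ∀ r f, X (expMode α r f) = expMode α r (X f) + c • expMode α' (r + n) f)
    (hβ : ∀ r f, X (expMode β r f) = expMode β r (X f) + c' • expMode β' (r + n) f)
    (s : ℤ) (f g : VQ ℓ) :
    coprod X (modeTensor α β s f g) = modeTensor α β s (X f) g + modeTensor α β s f (X g) +
      (c • modeTensor α' β (s + n) f g + c' • modeTensor α β' (s + n) f g) := by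
  have e1 : modeTensor α' β (s + n) f g =
      ∑ᶠ r : ℤ, expMode α' (r + n) f ⊗ₜ[ℂ] expMode β (s - r) g := by
    rw [modeTensor_apply, ← finsum_comp_equiv (Equiv.addRight n)]
    refine finsum_congr fun r => ?_
    rw [Equiv.coe_addRight, add_sub_add_right_eq_sub]
  have h1 : (Function.support fun r : ℤ =>
      expMode α' (r + n) f ⊗ₜ[ℂ] expMode β (s - r) g).Finite := by
    refine ((modeTensor_finite α' β (s + n) f g).preimage (f := fun r => r + n)
      (add_left_injective n).injOn).subset fun r hr => ?_
    simpa using hr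
  have e2 : modeTensor α β' (s + n) f g =
      ∑ᶠ r : ℤ, expMode α r f ⊗ₜ[ℂ] expMode β' (s - r + n) g := by
    rw [modeTensor_apply]
    refine finsum_congr fun r => ?_
    rw [sub_add_eq_add_sub]
  have h2 : (Function.support fun r : ℤ =>
      expMode α r f ⊗ₜ[ℂ] expMode β' (s - r + n) g).Finite := by
    simpa only [sub_add_eq_add_sub] using modeTensor_finite α β' (s + n) f g
  have h3 := modeTensor_finite α β s (X f) g
  have h4 := modeTensor_finite α β s f (X g)
  have h1' : (Function.support fun r : ℤ =>
      c • expMode α' (r + n) f ⊗ₜ[ℂ] expMode β (s - r) g).Finite :=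
    h1.subset fun r hr h => hr (by simp only [h, smul_zero])
  have h2' : (Function.support fun r : ℤ =>
      c' • expMode α r f ⊗ₜ[ℂ] expMode β' (s - r + n) g).Finite :=
    h2.subset fun r hr h => hr (by simp only [h, smul_zero])
  rw [e1, e2, modeTensor_apply, modeTensor_apply, modeTensor_apply,
    map_finsum (coprod X) (modeTensor_finite α β s f g), smul_finsum' c h1, smul_finsum' c' h2,
    ← finsum_add_distrib h3 h4, ← finsum_add_distrib h1' h2',
    ← finsum_add_distrib ((h3.union h4).subset (Function.support_add _ _))
      ((h1'.union h2').subset (Function.support_add _ _))]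
  refine finsum_congr fun r => ?_
  rw [coprod_tmul, hα, hβ, add_tmul, tmul_add, smul_tmul', tmul_smul]
  abel

/-- `∑_k Res_z z^m E^{v_k}(z) ⊗ E^{-v_k}(z)` -/
def casimir (ℓ : ℕ) (m : ℤ) : Module.End ℂ (VQ ℓ ⊗[ℂ] VQ ℓ) :=
  ∑ k, TensorProduct.lift (modeTensor (v k) (-v k) (m - 1))

theorem casimir_tmul {ℓ : ℕ} (m : ℤ) (f g : VQ ℓ) :
    casimir ℓ m (f ⊗ₜ g) = ∑ k, modeTensor (v k) (-v k) (m - 1) f g := by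
  simp [casimir]

theorem sum_v {ℓ : ℕ} (i : Fin ℓ) : ∑ j, (v i : Q ℓ) j = 1 := by
  simp [v, Pi.single_apply]

theorem sum_v_sub_v {ℓ : ℕ} (k l : Fin ℓ) : ∑ j, (v k - v l : Q ℓ) j = 0 := by
  simp only [Pi.sub_apply, Finset.sum_sub_distrib, sum_v, sub_self]

theorem coprod_casimir_heis {ℓ : ℕ} (h : Fin ℓ → ℂ) (n m : ℤ) (f g : VQ ℓ) :
    coprod (heis h n) (casimir ℓ m (f ⊗ₜ g)) =
      casimir ℓ m (coprod (heis h n) (f ⊗ₜ g)) := by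
  rw [coprod_tmul, map_add, casimir_tmul, casimir_tmul, casimir_tmul, map_sum,
    ← Finset.sum_add_distrib]
  refine Finset.sum_congr rfl fun k _ => ?_
  rw [coprod_modeTensor (heis_expMode h n (v k)) (heis_expMode h n (-v k)), dot_neg,
    ← add_smul, add_neg_cancel, zero_smul, add_zero]

/-- The operator `e^{v_k - v_l}` turns `E^{v_l}` into `E^{v_k}` and `E^{-v_k}` into `E^{-v_l}`, with
opposite signs. -/
theorem coprod_casimir_expMode {ℓ : ℕ} {k l : Fin ℓ} (hkl : k ≠ l) (n m : ℤ) (f g : VQ ℓ) :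
    coprod (expMode (v k - v l) n) (casimir ℓ m (f ⊗ₜ g)) =
      casimir ℓ m (coprod (expMode (v k - v l) n) (f ⊗ₜ g)) := by
  have hα := sum_v_sub_v k l
  have hc : epsC (v k - v l) (v l) + epsC (v k - v l) (-v k) = 0 := by
    rw [epsC_neg_right, epsC_sub_left, epsC_sub_left]
    simp only [epsC, eps_v_v]
    rcases lt_or_gt_of_ne hkl with h | h <;> simp [epsBasis, h, not_lt.2 h.le]
  have hp : ∀ j r f, expMode (v k - v l) n (expMode (v j) r f) =
      expMode (v j) r (expMode (v k - v l) n f) +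
        (if j = l then epsC (v k - v l) (v l) else 0) • expMode (v k) (r + n) f := by
    intro j r f
    split_ifs with h
    · subst h
      rw [expMode_comm_of_form_eq_neg_one hα
        (by rw [form_sub_left, form_v_v, form_v_v, if_neg hkl, if_pos rfl, zero_sub]),
        sub_add_cancel]
    · rw [zero_smul, add_zero, expMode_comm hα]
      rw [form_sub_left, form_v_v, form_v_v, if_neg (Ne.symm h)]
      split_ifs <;> simp
  have hm : ∀ j r f, expMode (v k - v l) n (expMode (-v j) r f) =
      expMode (-v j) r (expMode (v k - v l) n f) +
        (if j = k then epsC (v k - v l) (-v k) else 0) • expMode (-v l) (r + n) f := by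
    intro j r f
    split_ifs with h
    · subst h
      rw [expMode_comm_of_form_eq_neg_one hα
        (by rw [form_neg_right, form_sub_left, form_v_v, form_v_v, if_neg hkl.symm, if_pos rfl,
          sub_zero]), sub_add_eq_add_sub, add_neg_cancel, zero_sub]
    · rw [zero_smul, add_zero, expMode_comm hα]
      rw [form_neg_right, form_sub_left, form_v_v, form_v_v, if_neg (Ne.symm h)]
      split_ifs <;> simp
  rw [coprod_tmul, map_add, casimir_tmul, casimir_tmul, casimir_tmul, map_sum,
    ← Finset.sum_add_distrib]
  simp only [coprod_modeTensor (hp _) (hm _)]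
  rw [Finset.sum_add_distrib, Finset.sum_add_distrib (f := fun j => _ • _)]
  simp only [ite_smul, zero_smul, Finset.sum_ite_eq', Finset.mem_univ, if_true]
  rw [← add_smul, hc, zero_smul, add_zero]

/-- The operators of the affine Lie algebra commute with the bilinear operator. -/
theorem commute_casimir {ℓ : ℕ} {X : Module.End ℂ (VQ ℓ)} (hX : X ∈ affineAlg ℓ) (m : ℤ) :
    Commute (coprod X) (casimir ℓ m) := by
  refine TensorProduct.ext' fun f g => ?_
  rw [Module.End.mul_apply, Module.End.mul_apply]
  induction hX using Submodule.span_induction with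
  | mem X hX =>
    rcases hX with (⟨i, j, _, n⟩ | ⟨k, l, hkl, n⟩) | rfl
    · exact coprod_casimir_heis _ n m f g
    · have h := coprod_casimir_expMode hkl n m f g
      have e : coprod (epsC (v l) (v k) • expMode (v k - v l) n) =
          epsC (v l) (v k) • coprod (expMode (v k - v l) n) := by
        simp [coprod]
      rw [e, LinearMap.smul_apply, LinearMap.smul_apply, map_smul, h]
    · have e : coprod (1 : Module.End ℂ (VQ ℓ)) = (2 : ℂ) • 1 := by
        refine TensorProduct.ext' fun f g => ?_
        simp [coprod_tmul, two_smul]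
      rw [e, LinearMap.smul_apply, LinearMap.smul_apply, map_smul]
      rfl
  | zero => simp [coprod]
  | add X Y _ _ hX hY =>
    have e : coprod (X + Y) = coprod X + coprod Y := by
      simp only [coprod, LinearMap.rTensor_add, LinearMap.lTensor_add]
      abel
    rw [e, LinearMap.add_apply, LinearMap.add_apply, map_add, hX, hY]
  | smul c X _ hX =>
    have e : coprod (c • X) = c • coprod X := by simp [coprod]
    rw [e, LinearMap.smul_apply, LinearMap.smul_apply, map_smul, hX]

theorem casimir_vac {ℓ : ℕ} (m : ℕ) : casimir ℓ m (vac ℓ ⊗ₜ vac ℓ) = 0 := by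
  rw [casimir_tmul]
  refine Finset.sum_eq_zero fun k _ => ?_
  rw [modeTensor_apply]
  refine finsum_eq_zero_of_forall_eq_zero fun r => ?_
  have h : ∀ (α : Q ℓ) (r : ℤ), 0 ≤ r → expMode α r (vac ℓ) = 0 := by
    intro α r hr
    rw [vac, expMode_single, vertexS_one, schur_of_neg, smul_zero, Finsupp.single_zero]
    simp [form]
    omega
  rcases lt_or_ge r 0 with hr | hr
  · rw [h _ (m - 1 - r) (by omega), tmul_zero]
  · rw [h _ r hr, zero_tmul]

/-- The terms of `e^X f ⊗ e^X g` of degree `N` in `X` are those of `e^{X ⊗ 1 + 1 ⊗ X} (f ⊗ g)`. -/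
theorem sum_antidiagonal_tmul {V : Type*} [AddCommGroup V] [Module ℂ V] (X : Module.End ℂ V)
    (f g : V) (N : ℕ) :
    ∑ p ∈ Finset.HasAntidiagonal.antidiagonal N,
      (((p.1 ! : ℕ) : ℂ)⁻¹ • (X ^ p.1) f) ⊗ₜ[ℂ] (((p.2 ! : ℕ) : ℂ)⁻¹ • (X ^ p.2) g) =
    ((N ! : ℕ) : ℂ)⁻¹ • (coprod X ^ N) (f ⊗ₜ g) := by
  have hc : Commute (X.rTensor V) (X.lTensor V) := by
    refine TensorProduct.ext' fun f g => ?_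
    simp
  rw [coprod, hc.add_pow', LinearMap.sum_apply, Finset.smul_sum]
  refine Finset.sum_congr rfl fun p hp => ?_
  rw [← Finset.HasAntidiagonal.mem_antidiagonal.1 hp, LinearMap.smul_apply,
    ← Nat.cast_smul_eq_nsmul ℂ,
    Module.End.mul_apply, LinearMap.rTensor_pow, LinearMap.lTensor_pow,
    LinearMap.lTensor_tmul, LinearMap.rTensor_tmul, smul_tmul_smul, smul_smul]
  congr 1
  rw [Nat.choose_symm_add, Nat.add_choose,
    Nat.cast_div (Nat.factorial_mul_factorial_dvd_factorial_add _ _)]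
  · have h1 : (((p.1 + p.2)! : ℕ) : ℂ) ≠ 0 := by exact_mod_cast Nat.factorial_ne_zero _
    have h2 : ((p.1 ! : ℕ) : ℂ) ≠ 0 := by exact_mod_cast Nat.factorial_ne_zero _
    have h3 : ((p.2 ! : ℕ) : ℂ) ≠ 0 := by exact_mod_cast Nat.factorial_ne_zero _
    push_cast
    field_simp
  · exact_mod_cast mul_ne_zero (Nat.factorial_ne_zero _) (Nat.factorial_ne_zero _)

theorem casimir_sum_antidiagonal {ℓ : ℕ} {X : Module.End ℂ (VQ ℓ)} (hX : X ∈ affineAlg ℓ)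
    (m N : ℕ) :
    casimir ℓ m (∑ p ∈ Finset.HasAntidiagonal.antidiagonal N,
      (((p.1 ! : ℕ) : ℂ)⁻¹ • (X ^ p.1) (vac ℓ)) ⊗ₜ[ℂ] (((p.2 ! : ℕ) : ℂ)⁻¹ • (X ^ p.2) (vac ℓ))) =
      0 := by
  rw [sum_antidiagonal_tmul, map_smul, ← Module.End.mul_apply,
    ← ((commute_casimir hX m).pow_left N).eq, Module.End.mul_apply, casimir_vac, map_zero,
      smul_zero]

/-! ### Residues of formal power series in `x`, `x'`, `z`, `z⁻¹` -/

/-- The coefficient of `x^d z^p w^q`, which is `0` for negative `q`. -/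
def zwCoeff {ℓ : ℕ} (d : (Var ℓ ⊕ Var ℓ) →₀ ℕ) (p : ℕ) (q : ℤ) (H : Big ℓ) : ℂ :=
  if 0 ≤ q then MvPowerSeries.coeff (bigExp d p q.toNat) H else 0

theorem bigExp_inl {ℓ : ℕ} (d : (Var ℓ ⊕ Var ℓ) →₀ ℕ) (p q : ℕ) (s : Var ℓ ⊕ Var ℓ) :
    bigExp d p q (Sum.inl s) = d s := by
  simp [bigExp, Finsupp.mapDomain_apply Sum.inl_injective]

theorem bigExp_zero {ℓ : ℕ} (d : (Var ℓ ⊕ Var ℓ) →₀ ℕ) (p q : ℕ) :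
    bigExp d p q (Sum.inr 0) = p := by
  have : (d.mapDomain Sum.inl : BigVar ℓ →₀ ℕ) (Sum.inr 0) = 0 :=
    Finsupp.mapDomain_of_notMem_range _ _ (by simp)
  simp [bigExp, this]

theorem bigExp_one {ℓ : ℕ} (d : (Var ℓ ⊕ Var ℓ) →₀ ℕ) (p q : ℕ) :
    bigExp d p q (Sum.inr 1) = q := by
  have : (d.mapDomain Sum.inl : BigVar ℓ →₀ ℕ) (Sum.inr 1) = 0 :=
    Finsupp.mapDomain_of_notMem_range _ _ (by simp)
  simp [bigExp, this]

theorem eq_bigExp {ℓ : ℕ} {d : (Var ℓ ⊕ Var ℓ) →₀ ℕ} {p q : ℕ} {m : BigVar ℓ →₀ ℕ}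
    (h : ∀ s, m (Sum.inl s) = d s) (h0 : m (Sum.inr 0) = p) (h1 : m (Sum.inr 1) = q) :
    m = bigExp d p q := by
  refine Finsupp.ext fun s => ?_
  rcases s with s | s
  · rw [h, bigExp_inl]
  · fin_cases s
    · exact h0.trans (bigExp_zero d p q).symm
    · exact h1.trans (bigExp_one d p q).symm

theorem bigWeight_bigExp {ℓ : ℕ} (d : (Var ℓ ⊕ Var ℓ) →₀ ℕ) (p q : ℕ) :
    bigWeight (bigExp d p q) = bigWeight (d.mapDomain Sum.inl : BigVar ℓ →₀ ℕ) := by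
  simp [bigExp, bigWeight, Finsupp.weight_single]

theorem coeff_residue {ℓ : ℕ} (a : ℤ) (H : Big ℓ) (d : (Var ℓ ⊕ Var ℓ) →₀ ℕ) :
    MvPowerSeries.coeff d (residue a H) = ∑ᶠ p : ℕ, zwCoeff d p (a + 1 + p) H := by
  let e : {pq : ℕ × ℕ // a + pq.1 - pq.2 = -1} → ℕ := fun pq => pq.1.1
  have he : Function.Injective e := by
    rintro ⟨⟨p, q⟩, h⟩ ⟨⟨p', q'⟩, h'⟩ hpp
    simp only [e] at hpp h h'
    simp only [Subtype.mk.injEq, Prod.mk.injEq]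
    omega
  refine Eq.trans (finsum_congr fun pq => ?_)
    (finsum_comp_of_support_subset (f := fun p : ℕ => zwCoeff d p (a + 1 + p) H) he ?_)
  · obtain ⟨⟨p, q⟩, h⟩ := pq
    simp only at h
    change _ = zwCoeff d p (a + 1 + p) H
    rw [zwCoeff, if_pos (by omega), show (a + 1 + (p : ℤ)).toNat = q by omega]
  · intro p hp
    have h : 0 ≤ a + 1 + p := by
      by_contra h
      exact hp (if_neg h)
    exact ⟨⟨⟨p, (a + 1 + p).toNat⟩, by simp only; omega⟩, rfl⟩

theorem residue_finite {ℓ : ℕ} (a : ℤ) {H : Big ℓ} (hH : H ∈ zBounded ℓ)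
    (d : (Var ℓ ⊕ Var ℓ) →₀ ℕ) :
    (Function.support fun p : ℕ => zwCoeff d p (a + 1 + p) H).Finite := by
  refine (Set.finite_le_nat (bigWeight (d.mapDomain Sum.inl : BigVar ℓ →₀ ℕ))).subset fun p hp => ?_
  have h : 0 ≤ a + 1 + p := by
    by_contra h
    exact hp (if_neg h)
  have h2 := hH (bigExp d p (a + 1 + p).toNat) (by
    intro h0
    apply hp
    simp only
    rw [zwCoeff, if_pos h, h0])
  rwa [bigExp_zero, bigWeight_bigExp] at h2

theorem zwCoeff_add {ℓ : ℕ} (d : (Var ℓ ⊕ Var ℓ) →₀ ℕ) (p : ℕ) (q : ℤ) (H H' : Big ℓ) :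
    zwCoeff d p q (H + H') = zwCoeff d p q H + zwCoeff d p q H' := by
  simp only [zwCoeff, map_add]
  split_ifs <;> simp

theorem zwCoeff_smul {ℓ : ℕ} (d : (Var ℓ ⊕ Var ℓ) →₀ ℕ) (p : ℕ) (q : ℤ) (c : ℂ) (H : Big ℓ) :
    zwCoeff d p q (c • H) = c * zwCoeff d p q H := by
  simp only [zwCoeff, MvPowerSeries.coeff_smul]
  split_ifs <;> simp

theorem residue_add {ℓ : ℕ} (a : ℤ) {H H' : Big ℓ} (hH : H ∈ zBounded ℓ) (hH' : H' ∈ zBounded ℓ) :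
    residue a (H + H') = residue a H + residue a H' := by
  ext d
  rw [map_add, coeff_residue, coeff_residue, coeff_residue,
    ← finsum_add_distrib (residue_finite a hH d) (residue_finite a hH' d)]
  exact finsum_congr fun p => zwCoeff_add _ _ _ _ _

theorem residue_smul {ℓ : ℕ} (a : ℤ) (c : ℂ) (H : Big ℓ) :
    residue a (c • H) = c • residue a H := by
  ext d
  rw [MvPowerSeries.coeff_smul, coeff_residue, coeff_residue, ← smul_eq_mul, smul_finsum]
  exact finsum_congr fun p => zwCoeff_smul _ _ _ _ _

theorem residue_X_mul {ℓ : ℕ} (a : ℤ) (s : Var ℓ ⊕ Var ℓ) (H : Big ℓ) :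
    residue a (MvPowerSeries.X (Sum.inl s) * H) = MvPowerSeries.X s * residue a H := by
  classical
  ext d
  rw [MvPowerSeries.X, MvPowerSeries.X, MvPowerSeries.coeff_monomial_mul, coeff_residue, one_mul]
  have hle : ∀ p q, Finsupp.single (Sum.inl s) 1 ≤ bigExp d p q ↔ Finsupp.single s 1 ≤ d := by
    intro p q
    rw [Finsupp.single_le_iff, Finsupp.single_le_iff, bigExp_inl]
  split_ifs with h
  · rw [coeff_residue]
    refine finsum_congr fun p => ?_
    simp only [zwCoeff, MvPowerSeries.coeff_monomial_mul, hle, if_pos h, one_mul]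
    congr 3
    refine eq_bigExp (fun t => ?_) ?_ ?_
    · simp [Finsupp.tsub_apply, bigExp_inl, Finsupp.single_apply]
    · simp [Finsupp.tsub_apply, bigExp_zero]
    · simp [Finsupp.tsub_apply, bigExp_one]
  · refine finsum_eq_zero_of_forall_eq_zero fun p => ?_
    simp only [zwCoeff, MvPowerSeries.coeff_monomial_mul, hle, if_neg h, ite_self]

theorem residue_bw_pow_mul {ℓ : ℕ} (a : ℤ) (n : ℕ) (H : Big ℓ) :
    residue a (bw ^ n * H) = residue (a - n) H := by
  classical
  ext d
  rw [coeff_residue, coeff_residue]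
  refine finsum_congr fun p => ?_
  simp only [zwCoeff, bw, MvPowerSeries.X_pow_eq, MvPowerSeries.coeff_monomial_mul, one_mul,
    Finsupp.single_le_iff, bigExp_one]
  by_cases h : 0 ≤ a - n + 1 + p
  · rw [if_pos h, if_pos (by omega), if_pos (by omega)]
    congr 2
    refine eq_bigExp (fun t => ?_) ?_ ?_
    · simp [Finsupp.tsub_apply, bigExp_inl]
    · simp [Finsupp.tsub_apply, bigExp_zero]
    · simp only [Finsupp.tsub_apply, bigExp_one, Finsupp.single_eq_same]
      omega
  · rw [if_neg h]
    split_ifs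
    · omega
    · rfl
    · rfl

theorem smul_mem_zBounded {ℓ : ℕ} (c : ℂ) {H : Big ℓ} (hH : H ∈ zBounded ℓ) :
    c • H ∈ zBounded ℓ := fun m hm => hH m fun h => hm (by
  rw [MvPowerSeries.coeff_smul, h, mul_zero])

theorem X_mem_zBounded {ℓ : ℕ} (s : Var ℓ ⊕ Var ℓ) :
    (MvPowerSeries.X (Sum.inl s) : Big ℓ) ∈ zBounded ℓ := fun m hm => by
  rw [zBounded_X s m hm]
  exact Nat.zero_le _

theorem bw_mem_zBounded {ℓ : ℕ} : (bw : Big ℓ) ∈ zBounded ℓ := fun m hm => by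
  classical
  have : m = Finsupp.single (Sum.inr 1) 1 := by
    by_contra h
    exact hm (by rw [bw, MvPowerSeries.coeff_X, if_neg h])
  simp [this]

/-! ### The residue of the exponential factor -/

/-- The embedding of the letters other than `w`; `none` stands for `z`. -/
def withoutW (ℓ : ℕ) : Option (Var ℓ ⊕ Var ℓ) ↪ BigVar ℓ where
  toFun o := o.elim (Sum.inr 0) Sum.inl
  inj' := by rintro (_ | s) (_ | t) h <;> simp_all

/-- The specialization `w = 0`, as a power series in `z` over the power series in `x` and `x'`. -/
def specialize (ℓ : ℕ) : Big ℓ →ₐ[ℂ] PowerSeries (MvPowerSeries (Var ℓ ⊕ Var ℓ) ℂ) :=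
  (MvPowerSeries.optionEquivLeft (Var ℓ ⊕ Var ℓ) ℂ).toAlgHom.comp
    (MvPowerSeries.killCompl (R := ℂ) (withoutW ℓ))

theorem coeff_specialize {ℓ : ℕ} (H : Big ℓ) (p : ℕ) (d : (Var ℓ ⊕ Var ℓ) →₀ ℕ) :
    MvPowerSeries.coeff d (PowerSeries.coeff p (specialize ℓ H)) =
      MvPowerSeries.coeff (bigExp d p 0) H := by
  refine ((MvPowerSeries.coeff_coeff_optionEquivLeft _ p d).trans
    (MvPowerSeries.coeff_killCompl _ _)).trans ?_
  congr 2
  refine eq_bigExp (fun s => ?_) ?_ ?_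
  · exact (Finsupp.embDomain_apply_self (withoutW ℓ) _ (some s)).trans
      (Finsupp.optionElim_apply_some _ _ _)
  · exact (Finsupp.embDomain_apply_self (withoutW ℓ) _ none).trans
      (Finsupp.optionElim_apply_none _ _)
  · refine Finsupp.embDomain_of_notMem_range _ _ _ ?_
    rintro ⟨_ | s, hs⟩
    · exact absurd (show (Sum.inr 0 : BigVar ℓ) = Sum.inr 1 from hs) (by simp)
    · exact absurd (show (Sum.inl s : BigVar ℓ) = Sum.inr 1 from hs) (by simp)

theorem specialize_X {ℓ : ℕ} (s : Var ℓ ⊕ Var ℓ) :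
    specialize ℓ (MvPowerSeries.X (Sum.inl s)) = PowerSeries.C (MvPowerSeries.X s) :=
  (congrArg _ (MvPowerSeries.killCompl_X (some s))).trans
    (MvPowerSeries.optionEquivLeft_X_some s)

theorem specialize_bz {ℓ : ℕ} : specialize ℓ bz = PowerSeries.X :=
  (congrArg _ (MvPowerSeries.killCompl_X none)).trans MvPowerSeries.optionEquivLeft_X_none

theorem coeff_specialize_xi {ℓ : ℕ} (k : Fin ℓ) (n : ℕ+) :
    PowerSeries.coeff (n : ℕ) (specialize ℓ (xi k)) =
      MvPowerSeries.X (Sum.inl (k, n)) - MvPowerSeries.X (Sum.inr (k, n)) := by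
  ext d
  rw [coeff_specialize]
  have h : ∀ j : ℕ+, MvPowerSeries.coeff (bigExp d n 0) ((bx (k, j) - bx' (k, j)) * bz ^ (j : ℕ)) =
      if n = j then MvPowerSeries.coeff d
        (MvPowerSeries.X (Sum.inl (k, n)) - MvPowerSeries.X (Sum.inr (k, n)) :
          MvPowerSeries (Var ℓ ⊕ Var ℓ) ℂ) else 0 := by
    intro j
    rw [← coeff_specialize, map_mul, map_pow, map_sub, bx, bx', specialize_X, specialize_X,
      specialize_bz, ← map_sub, PowerSeries.coeff_C_mul, PowerSeries.coeff_X_pow]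
    by_cases hj : n = j
    · subst hj
      rw [if_pos rfl, if_pos rfl, mul_one]
    · rw [if_neg (by simpa using hj), if_neg hj, mul_zero, map_zero]
  refine (finsum_congr h).trans ?_
  rw [finsum_eq_single _ n (fun j hj => if_neg hj.symm), if_pos rfl]

theorem constantCoeff_specialize_xi {ℓ : ℕ} (k : Fin ℓ) :
    PowerSeries.constantCoeff (specialize ℓ (xi k)) = 0 := by
  rw [← PowerSeries.coeff_zero_eq_constantCoeff_apply]
  ext d
  rw [coeff_specialize, map_zero]
  refine finsum_eq_zero_of_forall_eq_zero fun n => ?_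
  by_contra h
  have := (coeff_xi_term k n _ h).1
  rw [bigExp_zero] at this
  exact n.ne_zero this.symm

theorem specialize_expXi {ℓ : ℕ} (k : Fin ℓ) :
    specialize ℓ (expXi k) = expSeries (specialize ℓ (xi k)) := by
  ext p d
  rw [coeff_specialize, expXi, PowerSeries.coeff_subst (hasSubst_xi k), expSeries,
    PowerSeries.coeff_mk, map_sum, finsum_eq_sum_of_support_subset (s := Finset.range (p + 1))]
  · refine Finset.sum_congr rfl fun j _ => ?_
    rw [PowerSeries.coeff_exp, MvPowerSeries.coeff_smul, ← coeff_specialize, map_pow]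
    simp
  · intro j hj
    simp only [Finset.coe_range, Set.mem_Iio]
    by_contra h
    apply hj
    simp only
    rw [← coeff_specialize, map_pow, coeff_pow_of_lt (constantCoeff_specialize_xi k) (by omega),
      map_zero, smul_zero]

/-- The power series in which `w` does not occur. -/
def wFree (ℓ : ℕ) : Submonoid (Big ℓ) where
  carrier := {H | ∀ m, MvPowerSeries.coeff m H ≠ 0 → m (Sum.inr 1) = 0}
  one_mem' := by
    classical
    intro m hm
    rw [MvPowerSeries.coeff_one] at hm
    have : m = 0 := by
      by_contra h
      exact hm (if_neg h)
    simp [this]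
  mul_mem' := by
    classical
    intro a b ha hb m hm
    rw [MvPowerSeries.coeff_mul] at hm
    obtain ⟨p, hp, hne⟩ := Finset.exists_ne_zero_of_sum_ne_zero hm
    rw [← Finset.HasAntidiagonal.mem_antidiagonal.1 hp, Finsupp.add_apply,
      ha _ (left_ne_zero_of_mul hne), hb _ (right_ne_zero_of_mul hne)]

theorem X_mem_wFree {ℓ : ℕ} {s : BigVar ℓ} (hs : s ≠ Sum.inr 1) :
    (MvPowerSeries.X s : Big ℓ) ∈ wFree ℓ := fun m hm => by
  classical
  have : m = Finsupp.single s 1 := by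
    by_contra h
    exact hm (by rw [MvPowerSeries.coeff_X, if_neg h])
  rw [this, Finsupp.single_apply, if_neg hs]

theorem expXi_mem_wFree {ℓ : ℕ} (k : Fin ℓ) : expXi k ∈ wFree ℓ := by
  have h1 : ∀ n : ℕ+, bx (k, n) - bx' (k, n) ∈ wFree ℓ := by
    intro n m hm
    by_cases h : MvPowerSeries.coeff m (bx (k, n)) = 0
    · refine X_mem_wFree (s := Sum.inl (Sum.inr (k, n))) (by simp) m fun h' => hm ?_
      rw [map_sub, h, bx', h', sub_zero]
    · exact X_mem_wFree (s := Sum.inl (Sum.inl (k, n))) (by simp) m h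
  have h2 : xi k ∈ wFree ℓ := by
    intro m hm
    obtain ⟨n, hn⟩ := exists_term_ne_zero
      (show ∑ᶠ n : ℕ+, MvPowerSeries.coeff m ((bx (k, n) - bx' (k, n)) * bz ^ (n : ℕ)) ≠ 0 from hm)
    exact (wFree ℓ).mul_mem (h1 n) (pow_mem (X_mem_wFree (by simp)) _) m hn
  intro m hm
  rw [expXi, PowerSeries.coeff_subst (hasSubst_xi k)] at hm
  obtain ⟨j, hj⟩ := exists_term_ne_zero hm
  exact pow_mem h2 j m (right_ne_zero_of_smul hj)

theorem residue_expXi {ℓ : ℕ} (k : Fin ℓ) (a : ℤ) :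
    residue a (expXi k) = zcoeff (-1 - a) (expSeries (specialize ℓ (xi k))) := by
  ext d
  rw [coeff_residue, ← specialize_expXi]
  have h : ∀ p : ℕ, a + 1 + p ≠ 0 → zwCoeff d p (a + 1 + p) (expXi k) = 0 := by
    intro p hp
    rw [zwCoeff]
    split_ifs with h
    · by_contra hne
      have := expXi_mem_wFree k _ hne
      rw [bigExp_one] at this
      omega
    · rfl
  rcases lt_or_ge (-1 - a) 0 with ha | ha
  · rw [zcoeff_of_neg ha, map_zero]
    exact finsum_eq_zero_of_forall_eq_zero fun p => h p (by omega)
  · obtain ⟨p, hp⟩ := Int.eq_ofNat_of_zero_le ha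
    rw [hp, zcoeff_natCast, coeff_specialize,
      finsum_eq_single _ p fun q hq => h q (by omega), zwCoeff, if_pos (by omega),
      show (a + 1 + (p : ℤ)).toNat = 0 by omega]

/-! ### Hirota expressions of polynomials in terms of vertex operators -/

/-- Two families of bilinear maps on the symmetric algebra that have the same commutation relations
with the generators agree as soon as they agree on `(1, 1)`. -/
theorem bilinear_eq_of_X_mul {ℓ : ℕ} {T : Type*} [CommRing T] [Algebra ℂ T]
    {Φ Ψ : ℤ → SymAlg ℓ →ₗ[ℂ] SymAlg ℓ →ₗ[ℂ] T} {y y' : Var ℓ → T} {c c' : Var ℓ → ℂ}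
    (hΦ : ∀ a p F G, Φ a (MvPolynomial.X p * F) G = y p * Φ a F G + c p • Φ (a - (p.2 : ℕ)) F G)
    (hΨ : ∀ a p F G, Ψ a (MvPolynomial.X p * F) G = y p * Ψ a F G + c p • Ψ (a - (p.2 : ℕ)) F G)
    (hΦ' : ∀ a p F G,
      Φ a F (MvPolynomial.X p * G) = y' p * Φ a F G + c' p • Φ (a - (p.2 : ℕ)) F G)
    (hΨ' : ∀ a p F G,
      Ψ a F (MvPolynomial.X p * G) = y' p * Ψ a F G + c' p • Ψ (a - (p.2 : ℕ)) F G)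
    (h1 : ∀ a, Φ a 1 1 = Ψ a 1 1) (a : ℤ) (F G : SymAlg ℓ) : Φ a F G = Ψ a F G := by
  induction F using MvPolynomial.induction_on generalizing a with
  | C c =>
    rw [← mul_one (MvPolynomial.C c), ← MvPolynomial.smul_eq_C_mul]
    simp only [map_smul, LinearMap.smul_apply]
    congr 1
    induction G using MvPolynomial.induction_on generalizing a with
    | C c => rw [← mul_one (MvPolynomial.C c), ← MvPolynomial.smul_eq_C_mul, map_smul, map_smul, h1]
    | add G G' hG hG' => rw [map_add, map_add, hG, hG']
    | mul_X G p hG => rw [mul_comm, hΦ', hΨ', hG, hG]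
  | add F F' hF hF' =>
    rw [map_add, map_add, LinearMap.add_apply, LinearMap.add_apply, hF, hF']
  | mul_X F p hF => rw [mul_comm, hΦ, hΨ, hF, hF]

/-- The rescaling `v_i s^{-n} ↦ n x_n^{(i)}` underlying `piMap`. -/
def rescale (ℓ : ℕ) : SymAlg ℓ →ₐ[ℂ] MvPolynomial (Var ℓ) ℂ :=
  MvPolynomial.aeval fun p : Var ℓ => ((p.2 : ℕ) : ℂ) • MvPolynomial.X p

theorem piMap_apply {ℓ : ℕ} (f : VQ ℓ) (γ : Q ℓ) : piMap ℓ f γ = rescale ℓ (f γ) := rfl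

/-- The rescaling followed by `x ↦ x - [z⁻¹]^{(k)}`. -/
def shiftHom {ℓ : ℕ} (k : Fin ℓ) : SymAlg ℓ →ₐ[ℂ] Big ℓ :=
  (MvPowerSeries.substAlgHom (hasSubst_shiftX k)).comp
    ((MvPolynomial.coeToMvPowerSeries.algHom ℂ).comp (rescale ℓ))

/-- The rescaling followed by `x ↦ x' + [z⁻¹]^{(k)}`. -/
def shiftHom' {ℓ : ℕ} (k : Fin ℓ) : SymAlg ℓ →ₐ[ℂ] Big ℓ :=
  (MvPowerSeries.substAlgHom (hasSubst_shiftX' k)).comp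
    ((MvPolynomial.coeToMvPowerSeries.algHom ℂ).comp (rescale ℓ))

theorem shiftHom_apply {ℓ : ℕ} (k : Fin ℓ) (F : SymAlg ℓ) :
    shiftHom k F = shiftX k (rescale ℓ F : MvPowerSeries (Var ℓ) ℂ) := by
  simp [shiftHom, shiftX, MvPowerSeries.coe_substAlgHom]

theorem shiftHom'_apply {ℓ : ℕ} (k : Fin ℓ) (F : SymAlg ℓ) :
    shiftHom' k F = shiftX' k (rescale ℓ F : MvPowerSeries (Var ℓ) ℂ) := by
  simp [shiftHom', shiftX', MvPowerSeries.coe_substAlgHom]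

theorem natCast_smul_zShift {ℓ : ℕ} (k : Fin ℓ) (p : Var ℓ) :
    ((p.2 : ℕ) : ℂ) • zShift k p = ((v k p.1 : ℤ) : ℂ) • bw ^ (p.2 : ℕ) := by
  have h : ((p.2 : ℕ) : ℂ) ≠ 0 := by exact_mod_cast p.2.ne_zero
  rw [zShift, v, Pi.single_apply]
  split_ifs
  · rw [smul_smul, mul_inv_cancel₀ h, Int.cast_one]
  · simp

theorem shiftHom_X {ℓ : ℕ} (k : Fin ℓ) (p : Var ℓ) : shiftHom k (MvPolynomial.X p) =
    ((p.2 : ℕ) : ℂ) • bx p - ((v k p.1 : ℤ) : ℂ) • bw ^ (p.2 : ℕ) := by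
  rw [← natCast_smul_zShift, ← smul_sub]
  simp [shiftHom, rescale, MvPowerSeries.coe_substAlgHom,
    MvPowerSeries.subst_smul (hasSubst_shiftX k),
    MvPowerSeries.subst_X (hasSubst_shiftX k)]

theorem shiftHom'_X {ℓ : ℕ} (k : Fin ℓ) (p : Var ℓ) : shiftHom' k (MvPolynomial.X p) =
    ((p.2 : ℕ) : ℂ) • bx' p + ((v k p.1 : ℤ) : ℂ) • bw ^ (p.2 : ℕ) := by
  rw [← natCast_smul_zShift, ← smul_add]
  simp [shiftHom', rescale, MvPowerSeries.coe_substAlgHom,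
    MvPowerSeries.subst_smul (hasSubst_shiftX' k),
    MvPowerSeries.subst_X (hasSubst_shiftX' k)]

theorem shiftHom_mem {ℓ : ℕ} (k : Fin ℓ) (F : SymAlg ℓ) : shiftHom k F ∈ zBounded ℓ := by
  rw [shiftHom_apply]
  exact shiftX_mem k _

theorem shiftHom'_mem {ℓ : ℕ} (k : Fin ℓ) (F : SymAlg ℓ) : shiftHom' k F ∈ zBounded ℓ := by
  rw [shiftHom'_apply]
  exact shiftX'_mem k _

theorem hirotaProduct_mem {ℓ : ℕ} (k : Fin ℓ) (F G : SymAlg ℓ) :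
    expXi k * shiftHom k F * shiftHom' k G ∈ zBounded ℓ :=
  mul_mem (mul_mem (expXi_mem k) (shiftHom_mem k F)) (shiftHom'_mem k G)

/-- The Hirota expression of polynomials, as a bilinear map on the symmetric algebra. -/
def hirotaBilin {ℓ : ℕ} (k : Fin ℓ) (a : ℤ) :
    SymAlg ℓ →ₗ[ℂ] SymAlg ℓ →ₗ[ℂ] MvPowerSeries (Var ℓ ⊕ Var ℓ) ℂ :=
  LinearMap.mk₂ ℂ (fun F G => residue a (expXi k * shiftHom k F * shiftHom' k G))
    (fun F F' G => by
      rw [map_add, mul_add, add_mul, residue_add _ (hirotaProduct_mem _ _ _)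
        (hirotaProduct_mem _ _ _)])
    (fun c F G => by
      rw [map_smul, mul_smul_comm, smul_mul_assoc, residue_smul])
    (fun F G G' => by
      rw [map_add, mul_add, residue_add _ (hirotaProduct_mem _ _ _) (hirotaProduct_mem _ _ _)])
    (fun c F G => by
      rw [map_smul, mul_smul_comm, residue_smul])

theorem hirotaBilin_apply {ℓ : ℕ} (k : Fin ℓ) (a : ℤ) (F G : SymAlg ℓ) : hirotaBilin k a F G =
    hirotaRes k a (rescale ℓ F : MvPowerSeries (Var ℓ) ℂ) (rescale ℓ G) := by
  rw [hirotaRes, ← shiftHom_apply, ← shiftHom'_apply]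
  rfl

theorem residue_generator_mul {ℓ : ℕ} (a : ℤ) (s : Var ℓ ⊕ Var ℓ) (c d : ℂ) (n : ℕ) {H : Big ℓ}
    (hH : H ∈ zBounded ℓ) :
    residue a ((c • MvPowerSeries.X (Sum.inl s) + d • bw ^ n) * H) =
      c • MvPowerSeries.X s * residue a H + d • residue (a - n) H := by
  rw [add_mul, smul_mul_assoc, smul_mul_assoc, residue_add, residue_smul, residue_smul,
    residue_X_mul, residue_bw_pow_mul, smul_mul_assoc]
  · exact smul_mem_zBounded _ (mul_mem (X_mem_zBounded s) hH)
  · exact smul_mem_zBounded _ (mul_mem (pow_mem bw_mem_zBounded n) hH)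

/-- The rescaling, with values in the power series in `x` and `x'`. -/
def inX {ℓ : ℕ} : SymAlg ℓ →ₐ[ℂ] MvPowerSeries (Var ℓ ⊕ Var ℓ) ℂ :=
  MvPolynomial.aeval fun p : Var ℓ => ((p.2 : ℕ) : ℂ) • MvPowerSeries.X (Sum.inl p)

/-- The rescaling with `x'` in place of `x`. -/
def inX' {ℓ : ℕ} : SymAlg ℓ →ₐ[ℂ] MvPowerSeries (Var ℓ ⊕ Var ℓ) ℂ :=
  MvPolynomial.aeval fun p : Var ℓ => ((p.2 : ℕ) : ℂ) • MvPowerSeries.X (Sum.inr p)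

theorem vertexS_mul_finite {ℓ : ℕ} (α β : Q ℓ) (b : ℤ) (F G : SymAlg ℓ) :
    (Function.support fun r : ℤ => inX (vertexS α r F) * inX' (vertexS β (b - r) G)).Finite := by
  obtain ⟨N, hN⟩ := vertexS_eq_zero α F
  obtain ⟨M, hM⟩ := vertexS_eq_zero β G
  refine (Set.finite_Icc N (b - M)).subset fun r hr => ?_
  constructor
  · by_contra h
    exact hr (by simp only; rw [hN r (by omega), map_zero, zero_mul])
  · by_contra h
    exact hr (by simp only; rw [hM (b - r) (by omega), map_zero, mul_zero])

/-- The coefficient of `z^{-a-1}` in the product of the vertex operators of `v_k` and `-v_k`, acting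
on polynomials in `x` and in `x'`. -/
def vertexBilin {ℓ : ℕ} (k : Fin ℓ) (a : ℤ) :
    SymAlg ℓ →ₗ[ℂ] SymAlg ℓ →ₗ[ℂ] MvPowerSeries (Var ℓ ⊕ Var ℓ) ℂ :=
  LinearMap.mk₂ ℂ (fun F G =>
      ∑ᶠ r : ℤ, inX (vertexS (v k) r F) * inX' (vertexS (-v k) (-1 - a - r) G))
    (fun F F' G => by
      rw [← finsum_add_distrib (vertexS_mul_finite _ _ _ F G) (vertexS_mul_finite _ _ _ F' G)]
      simp only [map_add, add_mul])
    (fun c F G => by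
      rw [smul_finsum' c (vertexS_mul_finite _ _ _ F G)]
      simp only [map_smul, smul_mul_assoc])
    (fun F G G' => by
      rw [← finsum_add_distrib (vertexS_mul_finite _ _ _ F G) (vertexS_mul_finite _ _ _ F G')]
      simp only [map_add, mul_add])
    (fun c F G => by
      rw [smul_finsum' c (vertexS_mul_finite _ _ _ F G)]
      simp only [map_smul, mul_smul_comm])

theorem vertexBilin_apply {ℓ : ℕ} (k : Fin ℓ) (a : ℤ) (F G : SymAlg ℓ) : vertexBilin k a F G =
    ∑ᶠ r : ℤ, inX (vertexS (v k) r F) * inX' (vertexS (-v k) (-1 - a - r) G) := rfl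

theorem vertexS_X_mul {ℓ : ℕ} (p : Var ℓ) (α : Q ℓ) (k : ℤ) (g : SymAlg ℓ) :
    vertexS α k (MvPolynomial.X p * g) =
      MvPolynomial.X p * vertexS α k g - (α p.1 : ℂ) • vertexS α (k + (p.2 : ℕ)) g := by
  rw [X_mul_vertexS, add_sub_cancel_right]

theorem vertexBilin_X_mul_left {ℓ : ℕ} (k : Fin ℓ) (a : ℤ) (p : Var ℓ) (F G : SymAlg ℓ) :
    vertexBilin k a (MvPolynomial.X p * F) G =
      ((p.2 : ℕ) : ℂ) • MvPowerSeries.X (Sum.inl p) * vertexBilin k a F G +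
        (-((v k p.1 : ℤ) : ℂ)) • vertexBilin k (a - (p.2 : ℕ)) F G := by
  have f0 := vertexS_mul_finite (v k) (-v k) (-1 - a) F G
  have e : vertexBilin k (a - (p.2 : ℕ)) F G = ∑ᶠ r : ℤ,
      inX (vertexS (v k) (r + (p.2 : ℕ)) F) * inX' (vertexS (-v k) (-1 - a - r) G) := by
    rw [vertexBilin_apply, ← finsum_comp_equiv (Equiv.addRight ((p.2 : ℕ) : ℤ))]
    refine finsum_congr fun r => ?_
    rw [Equiv.coe_addRight, show -1 - (a - ((p.2 : ℕ) : ℤ)) - (r + (p.2 : ℕ)) = -1 - a - r by ring]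
  have f1 : (Function.support fun r : ℤ =>
      inX (vertexS (v k) (r + (p.2 : ℕ)) F) * inX' (vertexS (-v k) (-1 - a - r) G)).Finite := by
    refine ((vertexS_mul_finite (v k) (-v k) (-1 - a + (p.2 : ℕ)) F G).preimage
      (f := fun r => r + ((p.2 : ℕ) : ℤ)) (add_left_injective _).injOn).subset fun r hr => ?_
    simpa using hr
  have f2 : (Function.support fun r : ℤ => ((p.2 : ℕ) : ℂ) • MvPowerSeries.X (Sum.inl p) *
      (inX (vertexS (v k) r F) * inX' (vertexS (-v k) (-1 - a - r) G))).Finite :=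
    f0.subset fun r hr h => hr (by simp only [h, mul_zero])
  have f3 : (Function.support fun r : ℤ => (-((v k p.1 : ℤ) : ℂ)) •
      (inX (vertexS (v k) (r + (p.2 : ℕ)) F) * inX' (vertexS (-v k) (-1 - a - r) G))).Finite :=
    f1.subset fun r hr h => hr (by simp only [h, smul_zero])
  rw [e, vertexBilin_apply, vertexBilin_apply, mul_finsum' _ _ f0, smul_finsum' _ f1,
    ← finsum_add_distrib f2 f3]
  refine finsum_congr fun r => ?_
  rw [vertexS_X_mul, map_sub, map_mul, map_smul, sub_mul, smul_mul_assoc, neg_smul,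
    ← sub_eq_add_neg,
    ← mul_assoc]
  congr 3
  simp [inX]

theorem vertexBilin_X_mul_right {ℓ : ℕ} (k : Fin ℓ) (a : ℤ) (p : Var ℓ) (F G : SymAlg ℓ) :
    vertexBilin k a F (MvPolynomial.X p * G) =
      ((p.2 : ℕ) : ℂ) • MvPowerSeries.X (Sum.inr p) * vertexBilin k a F G +
        ((v k p.1 : ℤ) : ℂ) • vertexBilin k (a - (p.2 : ℕ)) F G := by
  have f0 := vertexS_mul_finite (v k) (-v k) (-1 - a) F G
  have f1 := vertexS_mul_finite (v k) (-v k) (-1 - (a - (p.2 : ℕ))) F G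
  have f2 : (Function.support fun r : ℤ => ((p.2 : ℕ) : ℂ) • MvPowerSeries.X (Sum.inr p) *
      (inX (vertexS (v k) r F) * inX' (vertexS (-v k) (-1 - a - r) G))).Finite :=
    f0.subset fun r hr h => hr (by simp only [h, mul_zero])
  have f3 : (Function.support fun r : ℤ => ((v k p.1 : ℤ) : ℂ) •
      (inX (vertexS (v k) r F) * inX' (vertexS (-v k) (-1 - (a - (p.2 : ℕ)) - r) G))).Finite :=
    f1.subset fun r hr h => hr (by simp only [h, smul_zero])
  rw [vertexBilin_apply, vertexBilin_apply, vertexBilin_apply, mul_finsum' _ _ f0,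
    smul_finsum' _ f1,
    ← finsum_add_distrib f2 f3]
  refine finsum_congr fun r => ?_
  rw [vertexS_X_mul, map_sub, map_mul, map_smul, mul_sub, Pi.neg_apply, Int.cast_neg, neg_smul,
    mul_neg, sub_neg_eq_add, mul_smul_comm, mul_left_comm,
    show -1 - a - r + ((p.2 : ℕ) : ℤ) = -1 - (a - (p.2 : ℕ)) - r by ring]
  congr 2
  simp [inX']

theorem map_logSchur_v {ℓ : ℕ} (k : Fin ℓ) :
    PowerSeries.map (inX (ℓ := ℓ) : SymAlg ℓ →+* _) (logSchur (v k)) +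
      PowerSeries.map (inX' (ℓ := ℓ) : SymAlg ℓ →+* _) (logSchur (-v k)) =
        specialize ℓ (xi k) := by
  ext1 n
  rcases Nat.eq_zero_or_pos n with rfl | hn
  · simp only [map_add, PowerSeries.coeff_map, PowerSeries.coeff_zero_eq_constantCoeff_apply,
      constantCoeff_logSchur, constantCoeff_specialize_xi, map_zero, add_zero]
  · lift n to ℕ+ using hn
    rw [map_add, PowerSeries.coeff_map, PowerSeries.coeff_map, coeff_logSchur, coeff_logSchur,
      coeff_specialize_xi]
    simp [v, Pi.single_apply, inX, inX', smul_smul, sub_eq_add_neg]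

theorem map_schur {ℓ : ℕ} {T : Type*} [CommRing T] [Algebra ℂ T] (F : SymAlg ℓ →ₐ[ℂ] T) (α : Q ℓ)
    (k : ℤ) : F (schur α k) =
      zcoeff k (expSeries (PowerSeries.map (F : SymAlg ℓ →+* T) (logSchur α))) := by
  rw [schur_eq, ← map_expSeries]
  rcases lt_or_ge k 0 with hk | hk
  · rw [zcoeff_of_neg hk, zcoeff_of_neg hk, map_zero]
  · lift k to ℕ using hk
    rw [zcoeff_natCast, zcoeff_natCast, PowerSeries.coeff_map]
    rfl

/-- The Hirota expression of two polynomials is a residue of a product of vertex operators: both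
sides have the same commutators with the variables, and on `(1, 1)` both are the coefficient of
`z^{-1-a}` in `e^{ξ(x - x', z)}`. -/
theorem hirotaBilin_eq_vertexBilin {ℓ : ℕ} (k : Fin ℓ) (a : ℤ) (F G : SymAlg ℓ) :
    hirotaBilin k a F G = vertexBilin k a F G := by
  refine bilinear_eq_of_X_mul (Φ := hirotaBilin k) (Ψ := vertexBilin k) (fun a p F G => ?_)
    (vertexBilin_X_mul_left k) (fun a p F G => ?_) (vertexBilin_X_mul_right k) (fun a => ?_) a F G
  · have h := residue_generator_mul a (Sum.inl p) (((p.2 : ℕ) : ℂ)) (-((v k p.1 : ℤ) : ℂ)) p.2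
      (hirotaProduct_mem k F G)
    refine Eq.trans ?_ h
    change residue a (expXi k * shiftHom k (MvPolynomial.X p * F) * shiftHom' k G) = _
    rw [map_mul, shiftHom_X, neg_smul, ← sub_eq_add_neg, bx]
    congr 1
    ring
  · have h := residue_generator_mul a (Sum.inr p) (((p.2 : ℕ) : ℂ)) ((v k p.1 : ℤ) : ℂ) p.2
      (hirotaProduct_mem k F G)
    refine Eq.trans ?_ h
    change residue a (expXi k * shiftHom k F * shiftHom' k (MvPolynomial.X p * G)) = _
    rw [map_mul, shiftHom'_X, bx']
    congr 1
    ring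
  · change residue a (expXi k * shiftHom k 1 * shiftHom' k 1) = _
    rw [map_one, map_one, mul_one, mul_one, residue_expXi, vertexBilin_apply, ← map_logSchur_v,
      expSeries_add, zcoeff_mul]
    · simp only [vertexS_one, map_schur]
    · rw [← PowerSeries.coeff_zero_eq_constantCoeff_apply, PowerSeries.coeff_map,
        PowerSeries.coeff_zero_eq_constantCoeff_apply, constantCoeff_logSchur, map_zero]
    · rw [← PowerSeries.coeff_zero_eq_constantCoeff_apply, PowerSeries.coeff_map,
        PowerSeries.coeff_zero_eq_constantCoeff_apply, constantCoeff_logSchur, map_zero]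

open TensorProduct

/-- The map `f ⊗ g ↦ τ_γ(x) τ'_{γ'}(x')`, where `τ = Π(f)` and `τ' = Π(g)`. -/
def tauProduct {ℓ : ℕ} (γ γ' : Q ℓ) : VQ ℓ ⊗[ℂ] VQ ℓ →ₗ[ℂ] MvPowerSeries (Var ℓ ⊕ Var ℓ) ℂ :=
  LinearMap.mul' ℂ _ ∘ₗ TensorProduct.map (inX.toLinearMap ∘ₗ Finsupp.lapply γ)
    (inX'.toLinearMap ∘ₗ Finsupp.lapply γ')

theorem tauProduct_tmul {ℓ : ℕ} (γ γ' : Q ℓ) (f g : VQ ℓ) :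
    tauProduct γ γ' (f ⊗ₜ g) = inX (f γ) * inX' (g γ') := rfl

/-- The `k`-th summand of `Ω_m`, read on tau functions. The power of `z` and the sign come from the
factors `z^{α_{(0)}}` and `ε(α, ·)` of `E^{±v_k}(z)`. -/
theorem tauProduct_modeTensor {ℓ : ℕ} (k : Fin ℓ) (s : ℤ) (γ γ' : Q ℓ) (f g : VQ ℓ) :
    tauProduct γ γ' (modeTensor (v k) (-v k) s f g) = epsC (v k) (γ + γ') •
      hirotaRes k (form (v k) (γ - γ') + s - 1)
        (piMap ℓ f (γ - v k) : MvPowerSeries (Var ℓ) ℂ) (piMap ℓ g (γ' + v k)) := by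
  rw [piMap_apply, piMap_apply, ← hirotaBilin_apply, hirotaBilin_eq_vertexBilin, vertexBilin_apply,
    modeTensor_apply, map_finsum _ (modeTensor_finite _ _ _ _ _),
    smul_finsum' _ (vertexS_mul_finite _ _ _ _ _),
    ← finsum_comp_equiv (Equiv.subLeft (-form (v k) γ))]
  refine finsum_congr fun r => ?_
  rw [tauProduct_tmul, expMode_apply, expMode_apply, map_smul, map_smul, smul_mul_smul_comm,
    sub_neg_eq_add, Equiv.subLeft_apply]
  have hv : form (v k) (v k) = 1 := by rw [form_v_v, if_pos rfl]
  congr 1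
  · rw [epsC_neg_left, epsC_sub_right, epsC_add_right, epsC_add_right]
    linear_combination epsC (v k) γ * epsC (v k) γ' * epsC_mul_self (v k) (v k)
  · congr 4
    · rw [form_sub_right, hv]
      ring
    · rw [form_neg_left, form_add_right, form_sub_right, hv]
      ring

theorem tauProduct_casimir {ℓ : ℕ} (m : ℤ) (α β : Q ℓ) (i j : Fin ℓ) (f g : VQ ℓ) :
    tauProduct (α + v i) (β - v j) (casimir ℓ m (f ⊗ₜ[ℂ] g)) =
      ∑ k, epsC (v k) (α - β + v i + v j) •
        hirotaRes k (form (v k) (α - β) + m - 2 + kron i k + kron j k)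
          (piMap ℓ f (α + v i - v k) : MvPowerSeries (Var ℓ) ℂ) (piMap ℓ g (β - v j + v k)) := by
  rw [casimir_tmul, map_sum]
  refine Finset.sum_congr rfl fun k _ => ?_
  rw [tauProduct_modeTensor]
  have hk : ∀ i : Fin ℓ, form (v k) (v i) = kron i k := by
    intro i
    rw [form_v_v, kron]
    simp only [eq_comm]
  congr 1
  · simp only [epsC_add_right, epsC_sub_right]
    ring
  · congr 1
    simp only [form_add_right, form_sub_right, hk]
    ring

/-! ### Coefficientwise convergence -/

theorem hasSum_coeff_subst {σ τ : Type*} {a : σ → MvPowerSeries τ ℂ} (ha : MvPowerSeries.HasSubst a)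
    (e : τ →₀ ℕ) {F : ℕ → MvPowerSeries σ ℂ} {f : MvPowerSeries σ ℂ}
    (h : ∀ d, HasSum (fun n => MvPowerSeries.coeff d (F n)) (MvPowerSeries.coeff d f)) :
    HasSum (fun n => MvPowerSeries.coeff e ((F n).subst a))
      (MvPowerSeries.coeff e (f.subst a)) := by
  -- the exponents that matter for the coefficient `e` are those found for a series without zero
  -- coefficients
  have hfin : {d : σ →₀ ℕ | MvPowerSeries.coeff e (d.prod fun s n => a s ^ n) ≠ 0}.Finite := by
    let one : MvPowerSeries σ ℂ := fun _ => 1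
    refine (MvPowerSeries.coeff_subst_finite ha one e).subset fun d hd => ?_
    change (1 : ℂ) • MvPowerSeries.coeff e (d.prod fun s n => a s ^ n) ≠ 0
    rwa [one_smul]
  have key : ∀ g : MvPowerSeries σ ℂ, MvPowerSeries.coeff e (g.subst a) = ∑ d ∈ hfin.toFinset,
      MvPowerSeries.coeff d g * MvPowerSeries.coeff e (d.prod fun s n => a s ^ n) := by
    intro g
    rw [MvPowerSeries.coeff_subst ha]
    refine finsum_eq_sum_of_support_subset _ fun d hd => ?_
    rw [Set.Finite.coe_toFinset]
    exact right_ne_zero_of_smul hd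
  simp only [key]
  exact hasSum_sum fun d _ => (h d).mul_right _

theorem hasSum_mul {f g : ℕ → ℂ} {a b : ℂ} (hf : HasSum f a) (hg : HasSum g b) :
    HasSum (fun p : ℕ × ℕ => f p.1 * g p.2) (a * b) :=
  hf.mul hg (summable_mul_of_summable_norm hf.summable.norm hg.summable.norm)

/-- A coefficient of a Hirota expression is a finite bilinear combination of coefficients of its
arguments, so convergent series in the two arguments may be multiplied out. -/
theorem hasSum_coeff_hirotaRes {ℓ : ℕ} (k : Fin ℓ) (a : ℤ) (d : (Var ℓ ⊕ Var ℓ) →₀ ℕ)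
    {F G : ℕ → MvPowerSeries (Var ℓ) ℂ} {f g : MvPowerSeries (Var ℓ) ℂ}
    (hF : ∀ d, HasSum (fun n => MvPowerSeries.coeff d (F n)) (MvPowerSeries.coeff d f))
    (hG : ∀ d, HasSum (fun n => MvPowerSeries.coeff d (G n)) (MvPowerSeries.coeff d g)) :
    HasSum (fun p : ℕ × ℕ => MvPowerSeries.coeff d (hirotaRes k a (F p.1) (G p.2)))
      (MvPowerSeries.coeff d (hirotaRes k a f g)) := by
  classical
  have key : ∀ f g : MvPowerSeries (Var ℓ) ℂ, MvPowerSeries.coeff d (hirotaRes k a f g) =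
      ∑ p ∈ Finset.range (bigWeight (d.mapDomain Sum.inl : BigVar ℓ →₀ ℕ) + 1),
        zwCoeff d p (a + 1 + p) (expXi k * shiftX k f * shiftX' k g) := by
    intro f g
    rw [hirotaRes, coeff_residue]
    refine finsum_eq_sum_of_support_subset _ fun p hp => ?_
    have h : 0 ≤ a + 1 + p := by
      by_contra h
      exact hp (if_neg h)
    have h2 := mul_mem (mul_mem (expXi_mem k) (shiftX_mem k f)) (shiftX'_mem k g)
      (bigExp d p (a + 1 + p).toNat) (by
        intro h0
        apply hp
        simp only
        rw [zwCoeff, if_pos h, h0])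
    rw [bigExp_zero, bigWeight_bigExp] at h2
    simpa [Nat.lt_succ_iff] using h2
  simp only [key]
  refine hasSum_sum fun p _ => ?_
  simp only [zwCoeff]
  split_ifs with h
  · simp only [MvPowerSeries.coeff_mul, Finset.sum_mul]
    refine hasSum_sum fun x _ => hasSum_sum fun y _ => ?_
    simp only [mul_assoc]
    exact (hasSum_mul (hasSum_coeff_subst (hasSubst_shiftX k) _ hF)
      (hasSum_coeff_subst (hasSubst_shiftX' k) _ hG)).mul_left _
  · exact hasSum_zero

/-- Regrouping an absolutely convergent double series by total degree. -/
theorem eq_zero_of_hasSum_of_antidiagonal {Ψ : ℕ × ℕ → ℂ} {S : ℂ} (h : HasSum Ψ S)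
    (h0 : ∀ N, ∑ p ∈ Finset.HasAntidiagonal.antidiagonal N, Ψ p = 0) : S = 0 := by
  have h1 := (Finset.HasAntidiagonal.sigmaAntidiagonalEquivProd (A := ℕ)).hasSum_iff.2 h
  have h2 := h1.sigma (g := fun _ => 0) fun N => by
    have := Finset.hasSum (Finset.HasAntidiagonal.antidiagonal N) Ψ
    rwa [h0 N] at this
  exact h2.unique hasSum_zero

/-- The Hirota equations hold for the tau functions of the vacuum orbit. -/
theorem hirotaEquations_of_isVacuumTau {ℓ : ℕ} {X : Module.End ℂ (VQ ℓ)} (hX : X ∈ affineAlg ℓ)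
    {τ : Q ℓ → MvPowerSeries (Var ℓ) ℂ} (hτ : IsVacuumTau X τ) : HirotaEquations τ := by
  intro m α _ β _ i j
  ext d
  let w : ℕ → VQ ℓ := fun n => ((n ! : ℕ) : ℂ)⁻¹ • (X ^ n) (vac ℓ)
  have hw : ∀ γ e, HasSum (fun n => MvPowerSeries.coeff e
      (piMap ℓ (w n) γ : MvPowerSeries (Var ℓ) ℂ)) (MvPowerSeries.coeff e (τ γ)) := by
    intro γ e
    refine (hτ γ e).congr_fun fun n => ?_
    simp [w]
  have hsum : HasSum (fun p : ℕ × ℕ => MvPowerSeries.coeff d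
      (tauProduct (α + v i) (β - v j) (casimir ℓ m (w p.1 ⊗ₜ[ℂ] w p.2))))
      (MvPowerSeries.coeff d (∑ k, epsC (v k) (α - β + v i + v j) •
        hirotaRes k (form (v k) (α - β) + m - 2 + kron i k + kron j k)
          (τ (α + v i - v k)) (τ (β - v j + v k)))) := by
    simp only [tauProduct_casimir, map_sum, MvPowerSeries.coeff_smul]
    exact hasSum_sum fun k _ => (hasSum_coeff_hirotaRes k _ d (hw _) (hw _)).mul_left _
  rw [map_zero]
  refine eq_zero_of_hasSum_of_antidiagonal hsum fun N => ?_
  rw [← map_sum, ← map_sum, ← map_sum, casimir_sum_antidiagonal hX, map_zero, map_zero]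

/-! ### The charge of the tau functions -/

theorem heis_zero_apply {ℓ : ℕ} (h : Fin ℓ → ℂ) (f : VQ ℓ) (γ : Q ℓ) :
    heis h (Int.ofNat 0) f γ = dot h γ • f γ := by
  classical
  induction f using Finsupp.induction_linear with
  | zero => simp
  | add f g hf hg => rw [map_add, Finsupp.add_apply, hf, hg, Finsupp.add_apply, smul_add]
  | single β g =>
    rw [heis_zero_single, Finsupp.single_apply, Finsupp.single_apply]
    split_ifs with hβ
    · rw [hβ]
    · rw [smul_zero]

theorem affineAlg_apply_eq_zero {ℓ : ℕ} {X : Module.End ℂ (VQ ℓ)} (hX : X ∈ affineAlg ℓ) {f : VQ ℓ}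
    (hf : ∀ γ ∉ rootLattice ℓ, f γ = 0) {γ : Q ℓ} (hγ : γ ∉ rootLattice ℓ) : X f γ = 0 := by
  induction hX using Submodule.span_induction with
  | mem X hX =>
    rcases hX with (⟨i, j, _, n⟩ | ⟨k, l, _, n⟩) | rfl
    · rcases n with (_ | n) | n
      · rw [heis_zero_apply, hf γ hγ, smul_zero]
      · simp [heis, hf γ hγ]
      · simp [heis, hf γ hγ]
    · have hα : v k - v l ∈ rootLattice ℓ := sum_v_sub_v k l
      rw [LinearMap.smul_apply, Finsupp.smul_apply, expMode_apply, hf _ fun h => hγ ?_, map_zero,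
        smul_zero, smul_zero]
      simpa using add_mem h hα
    · exact hf γ hγ
  | zero => rfl
  | add X Y _ _ hX hY => rw [LinearMap.add_apply, Finsupp.add_apply, hX, hY, add_zero]
  | smul c X _ hX => rw [LinearMap.smul_apply, Finsupp.smul_apply, hX, smul_zero]

theorem tau_eq_zero_of_isVacuumTau {ℓ : ℕ} {X : Module.End ℂ (VQ ℓ)} (hX : X ∈ affineAlg ℓ)
    {τ : Q ℓ → MvPowerSeries (Var ℓ) ℂ} (hτ : IsVacuumTau X τ) {γ : Q ℓ} (hγ : γ ∉ rootLattice ℓ) :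
    τ γ = 0 := by
  have h : ∀ n : ℕ, ∀ γ ∉ rootLattice ℓ, (X ^ n) (vac ℓ) γ = 0 := by
    intro n
    induction n with
    | zero =>
      intro γ hγ
      rw [pow_zero, Module.End.one_apply, vac, Finsupp.single_eq_of_ne]
      rintro rfl
      exact hγ (zero_mem _)
    | succ n ih =>
      intro γ hγ
      rw [pow_succ', Module.End.mul_apply]
      exact affineAlg_apply_eq_zero hX ih hγ
  ext d
  rw [map_zero]
  refine (hτ γ d).unique (hasSum_zero.congr_fun fun n => ?_)
  rw [piMap_apply, h n γ hγ, map_zero, MvPolynomial.coeff_zero, mul_zero]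

/-! ### The reduced multi-component KP hierarchy -/

/-- The equations with `i = j = ℓ` imply all others, by the substitution `α ↦ α + v_i - v_ℓ`,
`β ↦ β - v_j + v_ℓ`. -/
theorem hirotaEquations_iff_reducedKP {ℓ : ℕ} [NeZero ℓ] (τ : Q ℓ → MvPowerSeries (Var ℓ) ℂ) :
    HirotaEquations τ ↔ ReducedKP (fun _ => 1) τ := by
  have hk : ∀ i k : Fin ℓ, form (v k) (v i) = kron i k := by
    intro i k
    rw [form_v_v, kron]
    simp only [eq_comm]
  constructor
  · intro h m α hα β hβ
    rw [← h m α hα β hβ (lastIdx ℓ) (lastIdx ℓ)]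
    refine Finset.sum_congr rfl fun k _ => ?_
    have hs : kron k (lastIdx ℓ) = kron (lastIdx ℓ) k := by simp only [kron, eq_comm]
    congr 1
    · simp only [epsC_add_right, epsC_sub_right]
      rw [mul_assoc, epsC_mul_self, mul_one]
    · congr 1
      rw [hs]
      push_cast
      ring
  · intro h m α hα β hβ i j
    have h' := h m (α + (v i - v (lastIdx ℓ))) (add_mem hα (sum_v_sub_v _ _))
      (β - (v j - v (lastIdx ℓ))) (sub_mem hβ (sum_v_sub_v _ _))
    rw [← h']
    refine Finset.sum_congr rfl fun k _ => ?_
    have hs : kron k (lastIdx ℓ) = kron (lastIdx ℓ) k := by simp only [kron, eq_comm]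
    congr 1
    · simp only [epsC_add_right, epsC_sub_right]
      linear_combination (-epsC (v k) α * epsC (v k) β * epsC (v k) (v i) * epsC (v k) (v j)) *
        epsC_mul_self (v k) (v (lastIdx ℓ))
    · congr 1
      · simp only [form_add_right, form_sub_right, hk, hs]
        push_cast
        ring
      · congr 1
        abel
      · congr 1
        abel

end LatticeVA

end

theorem mainTheorem6 (ℓ : ℕ) [NeZero ℓ] :
    (∀ X ∈ LatticeVA.affineAlg ℓ,
      ∀ τ : LatticeVA.Q ℓ → MvPowerSeries (LatticeVA.Var ℓ) ℂ, LatticeVA.IsVacuumTau X τ →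
        (∀ α ∉ LatticeVA.rootLattice ℓ, τ α = 0) ∧ LatticeVA.HirotaEquations τ) ∧
    (∀ τ : LatticeVA.Q ℓ → MvPowerSeries (LatticeVA.Var ℓ) ℂ,
      LatticeVA.HirotaEquations τ ↔ LatticeVA.ReducedKP (fun _ => 1) τ) :=
  ⟨fun _ hX _ hτ => ⟨fun _ hα => LatticeVA.tau_eq_zero_of_isVacuumTau hX hτ hα,
    LatticeVA.hirotaEquations_of_isVacuumTau hX hτ⟩, LatticeVA.hirotaEquations_iff_reducedKP⟩
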